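/- Let $\mathcal C$ be a small category with finite products in which all idempotents split (i.e. $\mathcal C$ is Cauchy complete), let $\mathrm{FP}(\mathcal C,\mathbf{Set})$ be the category of finite product preserving functors $\mathcal C\to\mathbf{Set}$ and natural transformations, and let $Y:\mathcal C^{op}\to \mathrm{FP}(\mathcal C,\mathbf{Set})$, $Y(c)=\mathcal C(c,-)$, be the Yoneda embedding. Conventions. An object $P$ of a category $\mathcal K$ is *projective* if $\mathcal K(P,-)$ sends regular epimorphisms to surjections, and *finite projective* if it is projective and finitely presentable. A *finitary variety* is a cocomplete, (Barr-)exact category with a small strong generator consisting of finite projective objects. A *symmetric monoidal finitary variety* is a symmetric monoidal closed category $(\mathcal V,\otimes,I)$ such that $\mathcal V$ is a finitary variety, $I$ is finitely presentable, and there is a small strong generator $\mathcal P$ of $\mathcal V$ consisting of finite projective objects such that $P\otimes Q$ is finite projective for all $P,Q\in\mathcal P$. Symmetric monoidal structures on a fixed category form a groupoid, in which a morphism $S\to S'$ is a symmetric strong monoidal structure on the identity functor, from the category with the structure $S$ to the category with the structure $S'$. Then there is an equivalence $E$ between * the groupoid of symmetric monoidal structures on $\mathcal C$ for which $-\otimes-:\mathcal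 C\times\mathcal C\to\mathcal C$ preserves finite products in each variable, and * the groupoid of symmetric monoidal structures on $\mathrm{FP}(\mathcal C,\mathbf{Set})$ which make it a symmetric monoidal finitary variety with projective unit. Moreover, corresponding structures make the Yoneda embedding symmetric strong monoidal: for every structure $S$ on $\mathcal C$ as in the first point, $Y:(\mathcal C,S)^{op}\to(\mathrm{FP}(\mathcal C,\mathbf{Set}),E(S))$ carries a symmetric strong monoidal structure, and these can be chosen compatibly with the morphisms: for each $f:S\to S'$, the identity is a monoidal natural transformation between the composite of $f^{op}:(\mathcal C,S)^{op}\to(\mathcal C,S')^{op}$ with $Y$ and the composite of $Y$ with $E(f)$. Likewise, for every structure $T$ on $\mathrm{FP}(\mathcal C,\mathbf{Set})$ as in the second point, $Y:(\mathcal C,E^{-1}(T))^{op}\to(\mathrm{FP}(\mathcal C,\mathbf{Set}),T)$ carries a symmetric strong monoidal structure, where $E^{-1}$ is a quasi-inverse of $E$. -/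

import Mathlib

open CategoryTheory Limits MonoidalCategory

universe w v u

/-! ### Finitary varieties -/

/-- A (Barr-)exact category: a regular category in which every internal equivalence relation is
effective (is the kernel pair of its coequalizer). -/
structure IsExactCategory (K : Type w) [Category.{v} K] : Prop where
  regular : Regular K
  effective : ∀ {R X : K} (p₁ p₂ : R ⟶ X), IsEquivalenceRelation p₁ p₂ →
    IsEffectiveEquivalenceRelation p₁ p₂

/-- `P` is (regular) projective: `Hom(P, -)` sends regular epimorphisms to surjections. -/
def IsRegularProjective {K : Type w} [Category.{v} K] (P : K) : Prop :=
  ∀ ⦃X Y : K⦄ (e : X ⟶ Y), IsRegularEpi e → Function.Surjective (fun g : P ⟶ X ↦ g ≫ e)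

/-- The finite projective objects: finitely presentable and (regular) projective. -/
def isFiniteProjective (K : Type w) [Category.{v} K] : ObjectProperty K :=
  fun P ↦ IsFinitelyPresentable.{v} P ∧ IsRegularProjective P

/-- `K` is a finitary quasivariety, as witnessed by the small strong generator `P` which consists
of finite projective objects. -/
structure IsFinitaryQuasivarietyWith (K : Type w) [Category.{v} K] (P : ObjectProperty K) :
    Prop where
  hasColimits : HasColimits K
  small : ObjectProperty.Small.{v} P
  isStrongGenerator : P.IsStrongGenerator
  le_isFiniteProjective : P ≤ isFiniteProjective K

/-- A finitary variety: an exact finitary quasivariety. -/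
structure IsFinitaryVariety (K : Type w) [Category.{v} K] : Prop where
  quasivariety : ∃ P : ObjectProperty K, IsFinitaryQuasivarietyWith K P
  exact : IsExactCategory K

/-- A symmetric monoidal finitary variety: a symmetric monoidal closed category whose underlying
category is a finitary variety, with finitely presentable unit, and with a small strong generator
of finite projective objects whose binary tensor products are finite projective. -/
structure IsSymmetricMonoidalFinitaryVariety (V : Type w) [Category.{v} V] [MonoidalCategory V]
    [SymmetricCategory V] : Prop where
  closed : Nonempty (MonoidalClosed V)
  finitaryVariety : IsFinitaryVariety V
  unit_isFinitelyPresentable : IsFinitelyPresentable.{v} (𝟙_ V)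
  exists_generator : ∃ P : ObjectProperty V, IsFinitaryQuasivarietyWith V P ∧
    ∀ X Y : V, P X → P Y → isFiniteProjective V (X ⊗ Y)

/-! ### The groupoid of symmetric monoidal structures on a category -/

/-- A symmetric monoidal structure on the category `C`. -/
structure SymMonStr (C : Type w) [Category.{v} C] where
  monoidal : MonoidalCategory C
  symmetric : SymmetricCategory C

namespace SymMonStr

variable {C : Type w} [Category.{v} C]

/-- The category `C`, regarded as a symmetric monoidal category by means of `S`. -/
def Carrier (_S : SymMonStr C) : Type w := C

instance (S : SymMonStr C) : Category.{v} S.Carrier := inferInstanceAs (Category.{v} C)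

instance (S : SymMonStr C) : MonoidalCategory S.Carrier := S.monoidal

instance (S : SymMonStr C) : SymmetricCategory S.Carrier := S.symmetric

/-- The identity functor of `C`, from `C` with the structure `S` to `C` with the structure `T`. -/
def change (S T : SymMonStr C) : S.Carrier ⥤ T.Carrier := 𝟭 C

/-- A morphism of symmetric monoidal structures on `C`: a symmetric strong monoidal structure on
the identity functor. All such morphisms are invertible. -/
@[ext]
structure Hom (S T : SymMonStr C) where
  braided : (change S T).Braided

lemma Hom.ext_of_lax {S T : SymMonStr C} {f g : Hom S T}
    (hε : f.braided.ε = g.braided.ε)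
    (hμ : ∀ X Y, f.braided.μ X Y = g.braided.μ X Y) : f = g := by
  apply Hom.ext
  apply Functor.Braided.toMonoidal_injective
  apply Functor.Monoidal.toLaxMonoidal_injective
  apply Functor.LaxMonoidal.ext
  · exact hε
  · funext X Y
    exact hμ X Y

instance : Category (SymMonStr C) where
  Hom S T := Hom S T
  id S := ⟨inferInstanceAs ((𝟭 S.Carrier).Braided)⟩
  comp {S T U} f g :=
    letI := f.braided
    letI := g.braided
    ⟨inferInstanceAs ((change S T ⋙ change T U).Braided)⟩
  id_comp {S T} f := Hom.ext_of_lax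
    (by exact (congrArg (f.braided.ε ≫ ·) ((change S T).map_id _)).trans (Category.comp_id _))
    (fun X Y ↦ by
      exact (congrArg (f.braided.μ X Y ≫ ·) ((change S T).map_id _)).trans (Category.comp_id _))
  comp_id {S T} f := Hom.ext_of_lax (by exact Category.id_comp f.braided.ε)
    (fun X Y ↦ by exact Category.id_comp (f.braided.μ X Y))
  assoc {S T U V} f g h := Hom.ext_of_lax
    (by exact (Category.assoc h.braided.ε g.braided.ε f.braided.ε).symm)
    (fun X Y ↦ by
      exact (Category.assoc (h.braided.μ X Y) (g.braided.μ X Y) (f.braided.μ X Y)).symm)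

end SymMonStr

/-- The opposite of a strong monoidal functor is strong monoidal. -/
@[reducible]
def opMonoidal {C : Type*} {D : Type*} [Category* C] [Category* D] [MonoidalCategory C]
    [MonoidalCategory D] (F : C ⥤ D) [F.Monoidal] : F.op.Monoidal where
  ε := (Functor.OplaxMonoidal.η F).op
  μ X Y := (Functor.OplaxMonoidal.δ F X.unop Y.unop).op
  η := (Functor.LaxMonoidal.ε F).op
  δ X Y := (Functor.LaxMonoidal.μ F X.unop Y.unop).op
  μ_natural_left f X := Quiver.Hom.unop_inj (by simp)
  μ_natural_right X f := Quiver.Hom.unop_inj (by simp)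
  associativity X Y Z := Quiver.Hom.unop_inj (by simp)
  left_unitality X := Quiver.Hom.unop_inj (by simp)
  right_unitality X := Quiver.Hom.unop_inj (by simp)
  δ_natural_left f X := Quiver.Hom.unop_inj (by simp)
  δ_natural_right X f := Quiver.Hom.unop_inj (by simp)
  oplax_associativity X Y Z := Quiver.Hom.unop_inj (by simp)
  oplax_left_unitality X := Quiver.Hom.unop_inj (by simp)
  oplax_right_unitality X := Quiver.Hom.unop_inj (by simp)
  ε_η := Quiver.Hom.unop_inj (by simp)
  η_ε := Quiver.Hom.unop_inj (by simp)
  μ_δ X Y := Quiver.Hom.unop_inj (by simp)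
  δ_μ X Y := Quiver.Hom.unop_inj (by simp)

/-! ### Finite product preserving functors -/

/-- `FP(C, Set)`: finite product preserving functors and all natural transformations. -/
abbrev FP (C : Type u) [SmallCategory C] : Type (u + 1) :=
  ObjectProperty.FullSubcategory (fun F : C ⥤ Type u ↦ PreservesFiniteProducts F)

/-- The Yoneda embedding `Cᵒᵖ ⥤ FP(C, Set)`, `X ↦ C(X, -)`. -/
def yonedaFP (C : Type u) [SmallCategory C] : Cᵒᵖ ⥤ FP C :=
  ObjectProperty.lift _ coyoneda (fun _ ↦ inferInstance)

/-- The property of a symmetric monoidal structure on `C` that the tensor product preserves finite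
products in each variable. -/
def tensorPreservesFiniteProducts (C : Type w) [Category.{v} C] :
    ObjectProperty (SymMonStr C) := fun S ↦
  ∀ X : S.Carrier, PreservesFiniteProducts (tensorLeft X) ∧ PreservesFiniteProducts (tensorRight X)

/-- The property of a symmetric monoidal structure on `K` that it makes `K` a symmetric monoidal
finitary variety with projective unit. -/
def isSMFVWithProjectiveUnit (K : Type w) [Category.{v} K] : ObjectProperty (SymMonStr K) := fun T ↦
  IsSymmetricMonoidalFinitaryVariety T.Carrier ∧ IsRegularProjective (𝟙_ T.Carrier)

section Yoneda

variable {C : Type u} [SmallCategory C]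

/-- The Yoneda embedding, from the opposite of the symmetric monoidal category `(C, S)` to the
symmetric monoidal category `(FP(C, Set), T)`. -/
def yonedaStr (S : SymMonStr C) (T : SymMonStr (FP C)) : S.Carrierᵒᵖ ⥤ T.Carrier :=
  yonedaFP C

/-- Let `y` and `y'` be strong monoidal structures on the Yoneda embeddings `(C, S)ᵒᵖ ⥤ (FP, T)` and
`(C, S')ᵒᵖ ⥤ (FP, T')`. The morphisms of structures `f : S ⟶ S'` and `g : T ⟶ T'` are compatible
with `y` and `y'` if the identity is a monoidal natural transformation between the two composites
`(C, S)ᵒᵖ ⥤ (C, S')ᵒᵖ ⥤ (FP, T')` and `(C, S)ᵒᵖ ⥤ (FP, T) ⥤ (FP, T')`. -/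
def YonedaCompatible {S S' : SymMonStr C} {T T' : SymMonStr (FP C)} (f : S ⟶ S') (g : T ⟶ T')
    (y : (yonedaStr S T).Braided) (y' : (yonedaStr S' T').Braided) : Prop :=
  letI : (SymMonStr.change S S').Braided := f.braided
  letI : (SymMonStr.change T T').Braided := g.braided
  letI : (SymMonStr.change S S').op.Monoidal := opMonoidal _
  letI τ : (SymMonStr.change S S').op ⋙ yonedaStr S' T' ⟶
    yonedaStr S T ⋙ SymMonStr.change T T' := 𝟙 (yonedaFP C)
  NatTrans.IsMonoidal τ

end Yoneda

-- The point is that `C` can be recovered from `FP C` as the opposite of its finite projective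
-- objects, and that symmetric monoidal closed structures on `FP C` are determined by what they do
-- on these objects.
--
-- In `FP C` the regular epimorphisms are the pointwise surjections, so quotients by equivalence
-- relations are computed pointwise, the category is exact, and the representables form a strong
-- generator of finite projectives (`isExactCategory`, `isFinitaryVariety`). A finite projective
-- object is a retract of a finite coproduct of generators. Yoneda turns products of `C` into
-- coproducts and idempotents split in `C`, so every finite projective object is representable
-- (`mem_isoClosure_representables`). For a structure of the second kind the unit and the tensor
-- products of representables are finite projective, hence representable, and the structure
-- restricts to `C` (`exists_braided_yonedaStr`). The restricted tensor preserves products because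
-- the closed tensor of `FP C` preserves coproducts.
--
-- Conversely, a structure on `C` extends by Day convolution: `F ⊗ G` represents the families `F c ×
-- G d → H (c ⊗ d)` natural in both variables (`exists_tensor`), and preservation of products by the
-- tensor of `C` keeps the functors `H (- ⊗ c)` and the internal homs inside `FP C`
-- (`exists_structure_FP`).
--
-- For morphisms, Yoneda is dense and the tensor is closed, so maps out of `F ⊗ G` are given by
-- natural values on pairs of representables. Hence, once Yoneda is strong monoidal for `(S, T)` and
-- for `(S', T')`, compatibility is a bijection between morphisms `S ⟶ S'` and `T ⟶ T'`
-- (`exists_yonedaCompatible_right`, `exists_yonedaCompatible_left` and their uniqueness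
-- counterparts). This bijection supplies functoriality, full faithfulness and essential
-- surjectivity at once.

universe w' v'

/-! ### Finite product preserving functors as local objects -/

namespace FPFunctor

variable {C : Type u} [SmallCategory C] [HasFiniteProducts C]

theorem preservesFiniteProducts_iff (F : C ⥤ Type u) :
    PreservesFiniteProducts F ↔ Nonempty (Unique (F.obj (⊤_ C))) ∧
      ∀ a b : C, Function.Bijective
        (fun z : F.obj (a ⨯ b) ↦ (F.map prod.fst z, F.map prod.snd z)) := by
  have key : ∀ a b : C, PreservesLimit (pair a b) F ↔ Function.Bijective
        (fun z : F.obj (a ⨯ b) ↦ (F.map prod.fst z, F.map prod.snd z)) := by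
    intro a b
    have e : prodComparison F a b ≫ (Types.binaryProductIso _ _).hom =
        ↾(fun z : F.obj (a ⨯ b) ↦ (F.map prod.fst z, F.map prod.snd z)) := by
      rw [← cancel_mono (Types.binaryProductIso _ _).inv]
      apply Limits.prod.hom_ext
      · simp [Types.binaryProductIso_inv_comp_fst]
        ext; rfl
      · simp [Types.binaryProductIso_inv_comp_snd]
        ext; rfl
    have h2 : IsIso (prodComparison F a b) ↔ Function.Bijective
        (fun z : F.obj (a ⨯ b) ↦ (F.map prod.fst z, F.map prod.snd z)) := by
      rw [← isIso_comp_right_iff (prodComparison F a b) (Types.binaryProductIso _ _).hom, e,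
        isIso_iff_bijective]
      rfl
    rw [← h2]
    exact ⟨fun _ ↦ inferInstance, fun _ ↦ PreservesLimitPair.of_iso_prod_comparison F a b⟩
  constructor
  · intro h
    exact ⟨⟨Types.isTerminalEquivUnique _ (isLimitOfHasTerminalOfPreservesLimit F)⟩,
      fun a b ↦ (key a b).1 inferInstance⟩
  · rintro ⟨⟨h1⟩, h2⟩
    have : PreservesLimit (Functor.empty.{0} C) F :=
      preservesTerminal_of_iso F
        (((Types.isTerminalEquivUnique _).symm h1).uniqueUpToIso terminalIsTerminal)
    have := preservesLimitsOfShape_pempty_of_preservesTerminal F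
    have : PreservesLimitsOfShape (Discrete WalkingPair) F :=
      ⟨fun {K} ↦ by
        have := (key (K.obj ⟨.left⟩) (K.obj ⟨.right⟩)).2 (h2 _ _)
        exact preservesLimit_of_iso_diagram F (diagramIsoPair K).symm⟩
    exact .of_preserves_binary_and_terminal F

/-- The maps whose local objects are the finite product preserving functors. -/
noncomputable def comparisonSource : Option (C × C) → (C ⥤ Type u)
  | none => ⊥_ _
  | some (a, b) => coyoneda.obj (.op a) ⨿ coyoneda.obj (.op b)

noncomputable def comparisonTarget : Option (C × C) → (C ⥤ Type u)
  | none => coyoneda.obj (.op (⊤_ C))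
  | some (a, b) => coyoneda.obj (.op (a ⨯ b))

noncomputable def comparison : ∀ i : Option (C × C), comparisonSource i ⟶ comparisonTarget i
  | none => initial.to _
  | some (a, b) => coprod.desc (coyoneda.map (prod.fst (X := a) (Y := b)).op)
      (coyoneda.map (prod.snd (X := a) (Y := b)).op)

variable (C) in
noncomputable def comparisonMaps : MorphismProperty (C ⥤ Type u) :=
  MorphismProperty.ofHoms (comparison (C := C))

/-- By Yoneda and the universal property of coproducts, precomposition with a comparison map is `F
(a ⨯ b) → F a × F b`, or the map from `F ⊤` to a one-point set in the nullary case. -/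
theorem isLocal_comparisonMaps_iff (F : C ⥤ Type u) :
    (comparisonMaps C).isLocal F ↔ PreservesFiniteProducts F := by
  have h0 : (comparisonMaps C).isLocal F ↔
      ∀ i, Function.Bijective (fun g : comparisonTarget i ⟶ F ↦ comparison (C := C) i ≫ g) := by
    constructor
    · intro h i
      exact h _ ⟨i⟩
    · rintro h _ _ _ ⟨i⟩
      exact h i
  rw [h0, preservesFiniteProducts_iff, Option.forall, Prod.forall]
  refine and_congr ?_ (forall_congr' fun a ↦ forall_congr' fun b ↦ ?_)
  · have e := coyonedaEquiv (X := ⊤_ C) (F := F)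
    have : Unique (⊥_ (C ⥤ Type u) ⟶ F) := uniqueFromInitial F
    constructor
    · intro h
      exact ⟨⟨⟨e ((Equiv.ofBijective _ h).symm (initial.to F))⟩, fun x ↦ e.symm.injective
        (h.1 (Subsingleton.elim (α := (⊥_ (C ⥤ Type u) ⟶ F)) _ _))⟩⟩
    · rintro ⟨h⟩
      exact ⟨fun x y _ ↦ e.injective (Subsingleton.elim _ _), fun y ↦ ⟨e.symm default,
        (Subsingleton.elim (α := (⊥_ (C ⥤ Type u) ⟶ F)) _ _)⟩⟩
  · let e := coyonedaEquiv (X := a ⨯ b) (F := F)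
    let e' : ((coyoneda.obj (.op a) ⨿ coyoneda.obj (.op b)) ⟶ F) ≃ F.obj a × F.obj b :=
      { toFun g := (coyonedaEquiv (coprod.inl ≫ g), coyonedaEquiv (coprod.inr ≫ g))
        invFun x := coprod.desc (coyonedaEquiv.symm x.1) (coyonedaEquiv.symm x.2)
        left_inv g := by
          apply coprod.hom_ext
          · simpa using coprod.inl_desc _ _
          · simpa using coprod.inr_desc _ _
        right_inv x := Prod.ext
          ((congrArg _ (coprod.inl_desc _ _)).trans (coyonedaEquiv.apply_symm_apply _))
          ((congrArg _ (coprod.inr_desc _ _)).trans (coyonedaEquiv.apply_symm_apply _)) }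
    refine Iff.trans (b := Function.Bijective ((e' ∘ (fun g : comparisonTarget (some (a, b)) ⟶ F ↦
        comparison (C := C) (some (a, b)) ≫ g)) ∘ e.symm)) ?_ ?_
    · exact ((Function.Bijective.of_comp_iff _ e.symm.bijective).trans
        (Function.Bijective.of_comp_iff' e'.bijective _)).symm
    suffices h : (e' ∘ (fun g : comparisonTarget (some (a, b)) ⟶ F ↦
        comparison (C := C) (some (a, b)) ≫ g)) ∘ e.symm =
        (fun z : F.obj (a ⨯ b) ↦ (F.map prod.fst z, F.map prod.snd z)) by rw [h]
    funext z
    have h : ∀ (c : C) (p : a ⨯ b ⟶ c), coyonedaEquiv (coyoneda.map p.op ≫ e.symm z) =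
        F.map p z := fun c p ↦ by simp [e, coyonedaEquiv]
    apply Prod.ext
    · refine Eq.trans ?_ (h a prod.fst)
      exact congrArg coyonedaEquiv (coprod.inl_desc_assoc _ _ _)
    · refine Eq.trans ?_ (h b prod.snd)
      exact congrArg coyonedaEquiv (coprod.inr_desc_assoc _ _ _)

attribute [local instance] Cardinal.fact_isRegular_aleph0

/-- Maps out of a representable are given by evaluation, which preserves colimits, and finite
coproducts inherit presentability. Finitely presentable ends are what makes the local objects
reflective with an inclusion that preserves filtered colimits. -/
theorem comparisonMaps_isCardinalPresentable ⦃X Y : C ⥤ Type u⦄ (f : X ⟶ Y)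
    (hf : comparisonMaps C f) : IsCardinalPresentable X Cardinal.aleph0.{u} ∧
      IsCardinalPresentable Y Cardinal.aleph0.{u} := by
  have hc : ∀ c : C, IsCardinalPresentable (coyoneda.obj (.op c)) Cardinal.aleph0.{u} := by
    intro c
    constructor
    intro J _ _
    let e : (coyoneda.obj (.op (coyoneda.obj (.op c)))) ≅ (evaluation C (Type u)).obj c :=
      NatIso.ofComponents (fun P ↦ Equiv.toIso coyonedaEquiv)
    exact preservesColimitsOfShape_of_natIso e.symm
  obtain ⟨i⟩ := hf
  constructor
  · match i with
    | none =>
      have : ∀ j : Discrete PEmpty.{1}, IsCardinalPresentable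
          ((Functor.empty.{0} (C ⥤ Type u)).obj j) Cardinal.aleph0.{u} := by
        rintro ⟨⟨⟩⟩
      exact isCardinalPresentable_of_isColimit _
        (colimit.isColimit (Functor.empty.{0} (C ⥤ Type u))) _
        (hasCardinalLT_aleph0_iff _ |>.2 inferInstance)
    | some (a, b) =>
      have : ∀ j : Discrete WalkingPair, IsCardinalPresentable ((pair (coyoneda.obj (.op a)) (coyoneda.obj (.op b))).obj j) Cardinal.aleph0.{u} := by
        rintro ⟨_ | _⟩ <;> exact hc _
      exact isCardinalPresentable_of_isColimit _ (colimit.isColimit (pair (coyoneda.obj (.op a)) (coyoneda.obj (.op b)))) _ (hasCardinalLT_aleph0_iff _ |>.2 inferInstance)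
  · match i with
    | none => exact hc _
    | some (a, b) => exact hc _

end FPFunctor

/-! ### The category `FP C`: Yoneda lemma, (co)limits, exactness -/

namespace FPFunctor

variable {C : Type u} [SmallCategory C]

/-- The Yoneda lemma for finite product preserving functors. -/
def yonedaEquiv {c : C} {F : FP C} : ((yonedaFP C).obj (.op c) ⟶ F) ≃ F.obj.obj c where
  toFun f := coyonedaEquiv f.hom
  invFun x := ⟨coyonedaEquiv.symm x⟩
  left_inv f := by ext1; exact coyonedaEquiv.symm_apply_apply f.hom
  right_inv x := coyonedaEquiv.apply_symm_apply x

lemma yonedaEquiv_comp {c : C} {F G : FP C} (x : (yonedaFP C).obj (.op c) ⟶ F) (f : F ⟶ G) :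
    yonedaEquiv (x ≫ f) = f.hom.app c (yonedaEquiv x) := rfl

lemma yonedaEquiv_symm_comp {c : C} {F G : FP C} (x : F.obj.obj c) (f : F ⟶ G) :
    yonedaEquiv.symm x ≫ f = yonedaEquiv.symm (f.hom.app c x) := by
  apply yonedaEquiv.injective
  rw [yonedaEquiv_comp, Equiv.apply_symm_apply, Equiv.apply_symm_apply]

lemma yonedaEquiv_map_comp {c d : C} {F : FP C} (p : c ⟶ d) (x : (yonedaFP C).obj (.op c) ⟶ F) :
    yonedaEquiv ((yonedaFP C).map p.op ≫ x) = F.obj.map p (yonedaEquiv x) := by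
  have := NatTrans.naturality_apply x.hom p (𝟙 c)
  refine Eq.trans ?_ this
  change x.hom.app d (p ≫ 𝟙 d) = x.hom.app d (𝟙 c ≫ p)
  rw [Category.comp_id, Category.id_comp]

lemma map_comp_yonedaEquiv_symm {c d : C} {F : FP C} (p : c ⟶ d) (x : F.obj.obj c) :
    (yonedaFP C).map p.op ≫ yonedaEquiv.symm x = yonedaEquiv.symm (F.obj.map p x) := by
  apply yonedaEquiv.injective
  rw [yonedaEquiv_map_comp, Equiv.apply_symm_apply, Equiv.apply_symm_apply]

lemma hom_ext {F G : FP C} {f g : F ⟶ G} (h : ∀ (c : C) (x : F.obj.obj c),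
    f.hom.app c x = g.hom.app c x) : f = g := by
  ext c x
  exact h c x

lemma hom_ext_yoneda {F G : FP C} {f g : F ⟶ G}
    (h : ∀ (c : C) (x : (yonedaFP C).obj (.op c) ⟶ F), x ≫ f = x ≫ g) : f = g := by
  apply hom_ext
  intro c x
  have := congrArg yonedaEquiv (h c (yonedaEquiv.symm x))
  rwa [yonedaEquiv_comp, yonedaEquiv_comp, Equiv.apply_symm_apply] at this

/-- A morphism given by its action on elements. -/
def homMk {F G : FP C} (φ : ∀ c, F.obj.obj c → G.obj.obj c)
    (h : ∀ (c d : C) (p : c ⟶ d) (x : F.obj.obj c), φ d (F.obj.map p x) = G.obj.map p (φ c x)) :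
    F ⟶ G :=
  ⟨{ app c := ↾(φ c)
     naturality c d p := by
      ext x
      exact h c d p x }⟩

@[simp]
lemma homMk_app {F G : FP C} (φ : ∀ c, F.obj.obj c → G.obj.obj c) (h) (c : C) (x : F.obj.obj c) :
    (homMk (F := F) (G := G) φ h).hom.app c x = φ c x := rfl

lemma comp_app {F G H : FP C} (f : F ⟶ G) (g : G ⟶ H) (c : C) (x : F.obj.obj c) :
    (f ≫ g).hom.app c x = g.hom.app c (f.hom.app c x) := rfl

lemma map_app {F G : FP C} (f : F ⟶ G) {c d : C} (p : c ⟶ d) (x : F.obj.obj c) :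
    f.hom.app d (F.obj.map p x) = G.obj.map p (f.hom.app c x) :=
  NatTrans.naturality_apply f.hom p x

instance : (yonedaFP C).Full where
  map_surjective {c d} f := by
    refine ⟨(yonedaEquiv (c := c.unop) f).op, ?_⟩
    apply yonedaEquiv.injective
    have := yonedaEquiv_map_comp (F := (yonedaFP C).obj d) (yonedaEquiv (c := c.unop) f) (𝟙 _)
    rw [Category.comp_id] at this
    refine this.trans ?_
    exact Category.id_comp _

instance : (yonedaFP C).Faithful where
  map_injective {c d} f g h := by
    have hh := congrArg (yonedaEquiv (c := c.unop)) h
    have := fun f : c ⟶ d ↦ yonedaEquiv_map_comp (F := (yonedaFP C).obj d) f.unop (𝟙 _)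
    simp only [Category.comp_id] at this
    have h2 : ((yonedaFP C).obj d).obj.map f.unop (yonedaEquiv (𝟙 _)) =
        ((yonedaFP C).obj d).obj.map g.unop (yonedaEquiv (𝟙 _)) :=
      (this f).symm.trans (hh.trans (this g))
    apply Quiver.Hom.unop_inj
    exact (Category.id_comp f.unop).symm.trans (h2.trans (Category.id_comp g.unop))

/-- A morphism which is surjective on elements. -/
def IsSurjective {X Y : FP C} (f : X ⟶ Y) : Prop :=
  ∀ c, Function.Surjective (f.hom.app c)

lemma IsSurjective.exists_lift {X Y : FP C} {f : X ⟶ Y} (hf : IsSurjective f) {c : Cᵒᵖ}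
    (y : (yonedaFP C).obj c ⟶ Y) : ∃ x : (yonedaFP C).obj c ⟶ X, x ≫ f = y := by
  obtain ⟨x, hx⟩ := hf c.unop (yonedaEquiv y)
  refine ⟨yonedaEquiv (c := c.unop).symm x, yonedaEquiv.injective ?_⟩
  rw [yonedaEquiv_comp]
  simpa using hx

lemma IsSurjective.of_exists_lift {X Y : FP C} {f : X ⟶ Y}
    (h : ∀ (c : Cᵒᵖ) (y : (yonedaFP C).obj c ⟶ Y), ∃ x : (yonedaFP C).obj c ⟶ X, x ≫ f = y) :
    IsSurjective f := by
  intro c y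
  obtain ⟨x, hx⟩ := h (.op c) (yonedaEquiv.symm y)
  exact ⟨yonedaEquiv x, by rw [← yonedaEquiv_comp, hx, Equiv.apply_symm_apply]⟩

lemma IsSurjective.epi {X Y : FP C} {f : X ⟶ Y} (hf : IsSurjective f) : Epi f where
  left_cancellation g h w := by
    apply hom_ext
    intro c y
    obtain ⟨x, rfl⟩ := hf c y
    rw [← comp_app, w, comp_app]

/-- Pointwise preimages may be chosen arbitrarily: `k` is constant on the fibres of `f`, and this
also forces naturality. -/
lemma IsSurjective.exists_desc {X Y Z : FP C} {f : X ⟶ Y} (hf : IsSurjective f) (k : X ⟶ Z)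
    (h : ∀ (c : C) (x x' : X.obj.obj c), f.hom.app c x = f.hom.app c x' →
      k.hom.app c x = k.hom.app c x') : ∃ k' : Y ⟶ Z, f ≫ k' = k := by
  choose s hs using hf
  refine ⟨homMk (fun c y ↦ k.hom.app c (s c y)) fun c d p y ↦ ?_, hom_ext fun c x ↦ ?_⟩
  · rw [← map_app]
    apply h
    rw [hs, map_app, hs]
  · rw [comp_app, homMk_app]
    exact h _ _ _ (hs c _)

lemma mono_of_injective {X Y : FP C} {m : X ⟶ Y} (h : ∀ c, Function.Injective (m.hom.app c)) :
    Mono m where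
  right_cancellation f g w := by
    apply hom_ext
    intro c x
    apply h
    rw [← comp_app, w, comp_app]

variable [HasFiniteProducts C]

lemma isLocal_comparisonMaps : (comparisonMaps C).isLocal =
    (fun F : C ⥤ Type u ↦ PreservesFiniteProducts F) := by
  ext F
  exact isLocal_comparisonMaps_iff F

attribute [local instance] Cardinal.fact_isRegular_aleph0

instance : (ObjectProperty.ι (fun F : C ⥤ Type u ↦ PreservesFiniteProducts F)).IsRightAdjoint := by
  rw [← isLocal_comparisonMaps]
  have : MorphismProperty.IsSmall.{u} (comparisonMaps C) := by
    unfold comparisonMaps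
    infer_instance
  exact (comparisonMaps C).isRightAdjoint_ι_isLocal _ comparisonMaps_isCardinalPresentable

instance : Functor.IsFinitelyAccessible.{u}
    (ObjectProperty.ι (fun F : C ⥤ Type u ↦ PreservesFiniteProducts F)) := by
  rw [← isLocal_comparisonMaps]
  exact (comparisonMaps C).isCardinalAccessible_ι_isLocal _ comparisonMaps_isCardinalPresentable

noncomputable instance : Reflective
    (ObjectProperty.ι (fun F : C ⥤ Type u ↦ PreservesFiniteProducts F)) where
  L := _
  adj := Adjunction.ofIsRightAdjoint _

instance hasColimits : HasColimits (FP C) :=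
  hasColimits_of_reflective (ObjectProperty.ι (fun F : C ⥤ Type u ↦ PreservesFiniteProducts F))

instance hasLimits : HasLimits (FP C) :=
  hasLimits_of_reflective (ObjectProperty.ι (fun F : C ⥤ Type u ↦ PreservesFiniteProducts F))

/-- The functor represented by `Y c` is the inclusion into presheaves followed by evaluation at `c`,
and the inclusion preserves filtered colimits. -/
instance isFinitelyPresentable_yoneda (c : Cᵒᵖ) :
    IsFinitelyPresentable.{u} ((yonedaFP C).obj c) where
  preservesColimitOfShape J _ _ := by
    let e : (coyoneda.obj (.op ((yonedaFP C).obj c))) ≅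
        (ObjectProperty.ι (fun F : C ⥤ Type u ↦ PreservesFiniteProducts F)) ⋙
          (evaluation C (Type u)).obj c.unop :=
      NatIso.ofComponents (fun P ↦ Equiv.toIso yonedaEquiv)
    have := Functor.preservesColimitsOfShape_of_isCardinalAccessible
      (ObjectProperty.ι (fun F : C ⥤ Type u ↦ PreservesFiniteProducts F)) Cardinal.aleph0.{u} J
    exact preservesColimitsOfShape_of_natIso e.symm

/-- Two elements with the same image are a map from a representable into the kernel pair, so a map
that coequalizes the kernel pair is constant on fibres and descends. -/
lemma IsSurjective.isRegularEpi {X Y : FP C} {f : X ⟶ Y} (hf : IsSurjective f) :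
    IsRegularEpi f := by
  have := hf.epi
  apply IsRegularEpi.of_epi_of_exists
  intro Z k hk
  refine hf.exists_desc k fun c x x' hx ↦ ?_
  have h1 : yonedaEquiv.symm x ≫ f = yonedaEquiv.symm x' ≫ f := by
    rw [yonedaEquiv_symm_comp, yonedaEquiv_symm_comp, hx]
  have h2 := congrArg (pullback.lift _ _ h1 ≫ ·) hk
  simp only [pullback.lift_fst_assoc, pullback.lift_snd_assoc, yonedaEquiv_symm_comp] at h2
  exact yonedaEquiv.symm.injective h2

lemma prod_ext (F : FP C) {a b : C} {z z' : F.obj.obj (a ⨯ b)}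
    (h₁ : F.obj.map prod.fst z = F.obj.map prod.fst z')
    (h₂ : F.obj.map prod.snd z = F.obj.map prod.snd z') : z = z' :=
  (((preservesFiniteProducts_iff F.obj).1 F.property).2 a b).1 (Prod.ext h₁ h₂)

lemma exists_prod (F : FP C) {a b : C} (x : F.obj.obj a) (y : F.obj.obj b) :
    ∃ z : F.obj.obj (a ⨯ b), F.obj.map prod.fst z = x ∧ F.obj.map prod.snd z = y := by
  obtain ⟨z, hz⟩ := (((preservesFiniteProducts_iff F.obj).1 F.property).2 a b).2 (x, y)
  exact ⟨z, congrArg Prod.fst hz, congrArg Prod.snd hz⟩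

/-- The pointwise quotient by a congruence stays in `FP C`: `hprod` gives injectivity of the
comparison with the product, and surjectivity is inherited from `X`. -/
lemma exists_quotient (X : FP C) (r : ∀ c, Setoid (X.obj.obj c))
    (hmap : ∀ (c d : C) (p : c ⟶ d) (x y : X.obj.obj c), (r c) x y →
      (r d) (X.obj.map p x) (X.obj.map p y))
    (hprod : ∀ (a b : C) (x y : X.obj.obj (a ⨯ b)),
      (r a) (X.obj.map prod.fst x) (X.obj.map prod.fst y) →
      (r b) (X.obj.map prod.snd x) (X.obj.map prod.snd y) → (r _) x y) :
    ∃ (Q : FP C) (q : X ⟶ Q), IsSurjective q ∧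
      ∀ c (x y : X.obj.obj c), q.hom.app c x = q.hom.app c y ↔ (r c) x y := by
  let Q : C ⥤ Type u :=
    { obj c := Quotient (r c)
      map {c d} p := ↾(Quotient.map (X.obj.map p) (hmap c d p))
      map_id c := by
        ext ⟨x⟩
        exact congrArg (Quotient.mk _) (by simp)
      map_comp p q := by
        ext ⟨x⟩
        exact congrArg (Quotient.mk _) (by simp) }
  have hQ : PreservesFiniteProducts Q := by
    rw [preservesFiniteProducts_iff]
    obtain ⟨⟨h1⟩, -⟩ := (preservesFiniteProducts_iff X.obj).1 X.property
    refine ⟨⟨⟨⟨Quotient.mk _ default⟩, ?_⟩⟩, fun a b ↦ ⟨?_, ?_⟩⟩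
    · rintro ⟨x⟩
      exact congrArg (Quotient.mk _) (Subsingleton.elim _ _)
    · rintro ⟨x⟩ ⟨y⟩ h
      exact Quotient.sound (hprod a b x y (Quotient.exact (congrArg Prod.fst h))
        (Quotient.exact (congrArg Prod.snd h)))
    · rintro ⟨⟨x⟩, ⟨y⟩⟩
      obtain ⟨z, rfl, rfl⟩ := exists_prod X x y
      exact ⟨Quotient.mk _ z, rfl⟩
  refine ⟨⟨Q, hQ⟩, homMk (fun c x ↦ Quotient.mk _ x) fun _ _ _ _ ↦ rfl, ?_, ?_⟩
  · rintro c ⟨x⟩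
    exact ⟨x, rfl⟩
  · intro c x y
    exact Quotient.eq

lemma exists_image {X Y : FP C} (f : X ⟶ Y) : ∃ (I : FP C) (q : X ⟶ I) (m : I ⟶ Y),
    q ≫ m = f ∧ IsSurjective q ∧ ∀ c, Function.Injective (m.hom.app c) := by
  obtain ⟨I, q, hq, hq'⟩ := exists_quotient X (fun c ↦ Setoid.ker (f.hom.app c))
    (fun c d p x y h ↦ by
      change f.hom.app d _ = f.hom.app d _
      rw [map_app, map_app]
      exact congrArg _ h)
    (fun a b x y h₁ h₂ ↦ by
      refine prod_ext Y ?_ ?_ <;> rw [← map_app, ← map_app]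
      exacts [h₁, h₂])
  obtain ⟨m, rfl⟩ := hq.exists_desc f (fun c x x' h ↦ (hq' _ _ _).1 h)
  refine ⟨I, q, m, rfl, hq, fun c x y h ↦ ?_⟩
  obtain ⟨x, rfl⟩ := hq c x
  obtain ⟨y, rfl⟩ := hq c y
  exact (hq' _ _ _).2 h

/-- In the image factorization of a regular epimorphism the injective part is both a monomorphism
and a strong epimorphism, hence invertible. -/
lemma isRegularEpi_iff {X Y : FP C} (f : X ⟶ Y) : IsRegularEpi f ↔ IsSurjective f := by
  refine ⟨fun hf ↦ ?_, fun hf ↦ hf.isRegularEpi⟩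
  obtain ⟨I, q, m, rfl, hq, hm⟩ := exists_image f
  have := mono_of_injective hm
  have : StrongEpi m := strongEpi_of_strongEpi q m
  have := isIso_of_mono_of_strongEpi m
  intro c y
  obtain ⟨x, hx⟩ := hq c ((inv m).hom.app c y)
  refine ⟨x, ?_⟩
  rw [comp_app, hx, ← comp_app, IsIso.inv_hom_id]
  rfl

lemma isRegularProjective_yoneda (c : Cᵒᵖ) : IsRegularProjective ((yonedaFP C).obj c) := by
  intro X Y e he y
  exact ((isRegularEpi_iff e).1 he).exists_lift y

instance regular : Regular (FP C) where
  hasCoequalizer_of_isKernelPair _ := inferInstance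
  regularEpiIsStableUnderBaseChange :=
    { of_isPullback {X Y Z W f g f' g'} sq hg := by
        have hg := (isRegularEpi_iff _).1 hg
        refine (isRegularEpi_iff _).2 (.of_exists_lift fun c y ↦ ?_)
        obtain ⟨x, hx⟩ := hg.exists_lift (y ≫ f)
        exact ⟨sq.lift x y hx, by simp⟩ }

/-- Tested on representables, an internal equivalence relation is a pointwise equivalence relation.
It is closed under products because `R` itself preserves them, so the pointwise quotient exists and
is effective. -/
lemma exists_kernelPair {R X : FP C} {p₁ p₂ : R ⟶ X} (e : EquivalenceRelation p₁ p₂) :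
    ∃ (Q : FP C) (q : X ⟶ Q), IsKernelPair q p₁ p₂ ∧ IsPushout p₁ p₂ q q := by
  have inj : ∀ (c : C) (x y : R.obj.obj c), p₁.hom.app c x = p₁.hom.app c y →
      p₂.hom.app c x = p₂.hom.app c y → x = y := by
    intro c x y h₁ h₂
    apply yonedaEquiv.symm.injective
    apply e.right_cancellation
    · rw [yonedaEquiv_symm_comp, h₁, yonedaEquiv_symm_comp]
    · rw [yonedaEquiv_symm_comp, h₂, yonedaEquiv_symm_comp]
  obtain ⟨Q, q, hq, hq'⟩ := exists_quotient X
    (fun c ↦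
      { r x y := ∃ z, p₁.hom.app c z = x ∧ p₂.hom.app c z = y
        iseqv :=
          { refl x := ⟨e.r.hom.app c x, by rw [← comp_app, e.reflexivity₁]; rfl,
              by rw [← comp_app, e.reflexivity₂]; rfl⟩
            symm := by
              rintro _ _ ⟨z, rfl, rfl⟩
              exact ⟨e.s.hom.app c z, by rw [← comp_app, e.symmetry₁],
                by rw [← comp_app, e.symmetry₂]⟩
            trans := by
              rintro _ _ _ ⟨z, rfl, rfl⟩ ⟨z', h, rfl⟩
              let l := PullbackCone.IsLimit.lift e.isLimit (yonedaEquiv.symm z)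
                (yonedaEquiv.symm z') (by rw [yonedaEquiv_symm_comp, yonedaEquiv_symm_comp, h])
              refine ⟨yonedaEquiv (l ≫ e.t), ?_, ?_⟩
              · rw [← yonedaEquiv_comp, Category.assoc, e.transitivity₁,
                  PullbackCone.IsLimit.lift_fst_assoc, yonedaEquiv_comp, Equiv.apply_symm_apply]
              · rw [← yonedaEquiv_comp, Category.assoc, e.transitivity₂,
                  PullbackCone.IsLimit.lift_snd_assoc, yonedaEquiv_comp,
                  Equiv.apply_symm_apply] } })
    (by
      rintro c d p _ _ ⟨z, rfl, rfl⟩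
      exact ⟨R.obj.map p z, map_app _ _ _, map_app _ _ _⟩)
    (by
      rintro a b x y ⟨z₁, h₁, h₁'⟩ ⟨z₂, h₂, h₂'⟩
      obtain ⟨z, rfl, rfl⟩ := exists_prod R z₁ z₂
      rw [map_app] at h₁ h₂ h₁' h₂'
      exact ⟨z, prod_ext X h₁ h₂, prod_ext X h₁' h₂'⟩)
  have w : p₁ ≫ q = p₂ ≫ q := hom_ext fun c z ↦ (hq' c _ _).2 ⟨z, rfl, rfl⟩
  have := hq.epi
  refine ⟨Q, q, ⟨⟨w⟩, ⟨PullbackCone.IsLimit.mk _ (fun s ↦ ?_) ?_ ?_ ?_⟩⟩,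
    ⟨⟨w⟩, ⟨PushoutCocone.IsColimit.mk _ (fun s ↦ ?_) ?_ ?_ ?_⟩⟩⟩
  · have h : ∀ c x, ∃ z, p₁.hom.app c z = s.fst.hom.app c x ∧ p₂.hom.app c z = s.snd.hom.app c x :=
      fun c x ↦ (hq' c _ _).1 (by rw [← comp_app, s.condition, comp_app])
    refine homMk (fun c x ↦ (h c x).choose) fun c d p x ↦ inj _ _ _ ?_ ?_
    · rw [(h _ _).choose_spec.1, map_app, map_app, (h _ _).choose_spec.1]
    · rw [(h _ _).choose_spec.2, map_app, map_app, (h _ _).choose_spec.2]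
  · intro s
    apply hom_ext
    intro c x
    rw [comp_app, homMk_app]
    generalize_proofs h
    exact h.choose_spec.1
  · intro s
    apply hom_ext
    intro c x
    rw [comp_app, homMk_app]
    generalize_proofs h
    exact h.choose_spec.2
  · intro s m h₁ h₂
    apply hom_ext
    intro c x
    rw [homMk_app]
    generalize_proofs h
    apply inj
    · rw [← comp_app, h₁, h.choose_spec.1]
    · rw [← comp_app, h₂, h.choose_spec.2]
  · refine (hq.exists_desc s.inl fun c x x' h ↦ ?_).choose
    obtain ⟨z, rfl, rfl⟩ := (hq' _ _ _).1 h
    -- The two legs agree because the reflexivity map is a common section of `p₁` and `p₂`.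
    have h3 : s.inl = s.inr := by
      have h4 := congrArg (e.r ≫ ·) s.condition
      simpa using h4
    rw [← comp_app, ← comp_app, s.condition, h3]
  · intro s
    generalize_proofs h
    exact h.choose_spec
  · intro s
    generalize_proofs h
    refine h.choose_spec.trans ?_
    have h4 := congrArg (e.r ≫ ·) s.condition
    simpa using h4
  · intro s m h₁ h₂
    generalize_proofs h
    rw [← cancel_epi q, h₁, h.choose_spec]

lemma isExactCategory : IsExactCategory (FP C) where
  regular := regular
  effective p₁ p₂ h := by
    obtain ⟨⟨e⟩⟩ := h
    obtain ⟨Q, q, h₁, h₂⟩ := exists_kernelPair e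
    exact ⟨⟨{ e with B := Q, π := q, isKernelPair := h₁, isPushout := h₂ }⟩⟩

variable (C) in
/-- The representable functors. -/
def representables : ObjectProperty (FP C) := ObjectProperty.ofObj (yonedaFP C).obj

/-- Lifting maps from representables through `i` means surjectivity on elements, so a monomorphism
with this property is also a regular epimorphism. -/
lemma isStrongGenerator_representables : (representables C).IsStrongGenerator := by
  rw [ObjectProperty.isStrongGenerator_iff]
  refine ⟨fun X Y f g h ↦ hom_ext_yoneda fun c x ↦ h _ ⟨_⟩ x, fun X Y i _ h ↦ ?_⟩
  have hi : IsSurjective i := .of_exists_lift fun c y ↦ h _ ⟨_⟩ y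
  have := hi.isRegularEpi
  exact isIso_of_mono_of_strongEpi i

lemma isFinitaryQuasivarietyWith_representables :
    IsFinitaryQuasivarietyWith (FP C) (representables C) where
  hasColimits := hasColimits
  small := by unfold representables; infer_instance
  isStrongGenerator := isStrongGenerator_representables
  le_isFiniteProjective := by
    rintro _ ⟨c⟩
    exact ⟨inferInstance, isRegularProjective_yoneda c⟩

lemma isFinitaryVariety : IsFinitaryVariety (FP C) where
  quasivariety := ⟨_, isFinitaryQuasivarietyWith_representables⟩
  exact := isExactCategory

end FPFunctor

/-! ### Finite projective objects in a variety -/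

namespace FiniteProjective

variable {K : Type w} [Category.{v} K]

attribute [local instance] Cardinal.fact_isRegular_aleph0

lemma IsRegularProjective.of_retract {X Y : K} (r : Retract X Y) (h : IsRegularProjective Y) :
    IsRegularProjective X := by
  intro A B e he f
  obtain ⟨g, hg⟩ := h e he (r.r ≫ f)
  exact ⟨r.i ≫ g, by simpa using congrArg (r.i ≫ ·) hg⟩

instance : (isFiniteProjective K).IsStableUnderRetracts where
  of_retract r h := by
    have := h.1
    exact ⟨r.isCardinalPresentable _, IsRegularProjective.of_retract r h.2⟩

lemma isFiniteProjective_of_iso {X Y : K} (e : X ≅ Y) (h : isFiniteProjective K X) :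
    isFiniteProjective K Y :=
  (isFiniteProjective K).prop_of_retract ⟨e.inv, e.hom, e.inv_hom_id⟩ h

lemma isFiniteProjective_sigma {ι : Type v} [Finite ι] (A : ι → K) [HasCoproduct A]
    (h : ∀ i, isFiniteProjective K (A i)) : isFiniteProjective K (∐ A) := by
  constructor
  · have : LocallySmall.{v} K := inferInstance
    have : ∀ i : Discrete ι, IsFinitelyPresentable.{v} ((Discrete.functor A).obj i) :=
      fun i ↦ (h i.as).1
    exact isCardinalPresentable_of_isColimit.{v} _ (colimit.isColimit (Discrete.functor A)) _
        (hasCardinalLT_aleph0_iff _ |>.2 inferInstance)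
  · intro X Y e he f
    choose g hg using fun i ↦ (h i).2 e he (Sigma.ι A i ≫ f)
    refine ⟨Sigma.desc g, Sigma.hom_ext _ _ fun i ↦ ?_⟩
    have := hg i
    dsimp only at this ⊢
    rw [← this, Sigma.ι_desc_assoc]

open CoproductsFromFiniteFiltered in
-- The strong generator covers `X` by a coproduct of generators. Projectivity splits the cover, and
-- finite presentability makes the section factor through a finite subcoproduct.
lemma exists_retract_sigma [HasColimits K] [Regular K] {P : ObjectProperty K}
    [ObjectProperty.Small.{v} P] (hP : P.IsStrongGenerator) {X : K}
    (hX : isFiniteProjective K X) :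
    ∃ (ι : Type v) (_ : Finite ι) (A : ι → K), (∀ i, P (A i)) ∧ Nonempty (Retract X (∐ A)) := by
  obtain ⟨ι, A, hA, c, hc, p, hp⟩ :=
    ObjectProperty.isStrongGenerator_iff_exists_extremalEpi.1 hP X
  -- Projectivity applies since an extremal epimorphism in a regular category is regular.
  obtain ⟨s, hs⟩ := hX.2 p inferInstance (𝟙 X)
  have := hX.1
  let e := hc.coconePointUniqueUpToIso (colimit.isColimit (Discrete.functor A))
  obtain ⟨S, g, hg⟩ := IsFinitelyPresentable.exists_hom_of_isColimit
    (isColimitFiniteSubproductsCocone A) (s ≫ e.hom)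
  refine ⟨{ i // i ∈ S }, inferInstance, fun i ↦ A i.1.as, fun i ↦ hA _,
    ⟨⟨g, (finiteSubcoproductsCocone A).ι.app S ≫ e.inv ≫ p, ?_⟩⟩⟩
  have h := congrArg (· ≫ e.inv ≫ p) hg
  have h' : (s ≫ e.hom) ≫ e.inv ≫ p = 𝟙 X := by
    rw [Category.assoc, Iso.hom_inv_id_assoc]
    exact hs
  exact (Category.assoc _ _ _).symm.trans (h.trans h')

/-- The closed tensor preserves coproducts in each variable, and every functor preserves retracts,
so the claim reduces to pairs of objects of the given generator. -/
lemma isFiniteProjective_tensor [MonoidalCategory K] [SymmetricCategory K]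
    (hK : IsSymmetricMonoidalFinitaryVariety K) {X Y : K} (hX : isFiniteProjective K X)
    (hY : isFiniteProjective K Y) : isFiniteProjective K (X ⊗ Y) := by
  obtain ⟨⟨_⟩, ⟨-, hR, -⟩, -, P, ⟨_, _, hP, -⟩, hP'⟩ := hK
  have (Z : K) : PreservesColimits (tensorRight Z) :=
    preservesColimits_of_natIso (BraidedCategory.tensorLeftIsoTensorRight Z)
  obtain ⟨ι, _, A, hA, ⟨r⟩⟩ := exists_retract_sigma hP hX
  obtain ⟨κ, _, B, hB, ⟨t⟩⟩ := exists_retract_sigma hP hY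
  have h₁ : ∀ i, isFiniteProjective K (A i ⊗ Y) := fun i ↦ by
    refine (isFiniteProjective K).prop_of_retract (t.map (tensorLeft (A i))) ?_
    exact isFiniteProjective_of_iso (PreservesCoproduct.iso (tensorLeft (A i)) B).symm
      (isFiniteProjective_sigma _ fun j ↦ hP' _ _ (hA i) (hB j))
  refine (isFiniteProjective K).prop_of_retract (r.map (tensorRight Y)) ?_
  exact isFiniteProjective_of_iso (PreservesCoproduct.iso (tensorRight Y) A).symm
    (isFiniteProjective_sigma _ h₁)

end FiniteProjective

/-! ### Finite projective objects of `FP C` are representable -/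

namespace FPFunctor

open FiniteProjective

variable {C : Type u} [SmallCategory C] [HasFiniteProducts C]

/-- Maps from `Y (a ⨯ b)` to `F` are elements of `F (a ⨯ b)`, that is, pairs of elements; so `Y`
sends products of `C` to coproducts of `FP C`. -/
instance : PreservesFiniteProducts (yonedaFP C).rightOp := by
  have h₀ : PreservesLimit (Functor.empty.{0} C) (yonedaFP C).rightOp := by
    have h (F : FP C) : Unique ((yonedaFP C).obj (.op (⊤_ C)) ⟶ F) := by
      have := ((preservesFiniteProducts_iff F.obj).1 F.property).1.some
      exact yonedaEquiv.unique
    have hI : IsInitial ((yonedaFP C).obj (.op (⊤_ C))) := IsInitial.ofUnique _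
    exact preservesLimit_of_preserves_limit_cone terminalIsTerminal
      ((isLimitMapConeEmptyConeEquiv _ _).symm hI.op)
  have := preservesLimitsOfShape_pempty_of_preservesTerminal (yonedaFP C).rightOp
  have h₂ (a b : C) : PreservesLimit (pair a b) (yonedaFP C).rightOp := by
    refine preservesLimit_of_preserves_limit_cone (prodIsProd a b)
      ((isLimitMapConeBinaryFanEquiv _ _ _).symm ?_)
    have h (s : BinaryFan ((yonedaFP C).rightOp.obj a) ((yonedaFP C).rightOp.obj b)) :=
      exists_prod s.pt.unop (yonedaEquiv s.fst.unop) (yonedaEquiv s.snd.unop)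
    refine BinaryFan.isLimitMk (fun s ↦ (yonedaEquiv.symm (h s).choose).op) ?_ ?_ ?_
    · intro s
      apply Quiver.Hom.unop_inj
      refine (map_comp_yonedaEquiv_symm _ _).trans ?_
      rw [(h s).choose_spec.1]
      exact Equiv.symm_apply_apply _ _
    · intro s
      apply Quiver.Hom.unop_inj
      refine (map_comp_yonedaEquiv_symm _ _).trans ?_
      rw [(h s).choose_spec.2]
      exact Equiv.symm_apply_apply _ _
    · intro s m h₁ h₂
      apply Quiver.Hom.unop_inj
      apply yonedaEquiv.injective
      refine Eq.trans ?_ (Equiv.apply_symm_apply _ _).symm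
      apply prod_ext
      · rw [(h s).choose_spec.1, ← h₁]
        exact (yonedaEquiv_map_comp _ _).symm
      · rw [(h s).choose_spec.2, ← h₂]
        exact (yonedaEquiv_map_comp _ _).symm
  have : PreservesLimitsOfShape (Discrete WalkingPair) (yonedaFP C).rightOp :=
    ⟨fun {K} ↦ preservesLimit_of_iso_diagram _ (diagramIsoPair K).symm⟩
  exact .of_preserves_binary_and_terminal _

lemma exists_iso_sigma_yoneda {ι : Type u} [Finite ι] (A : ι → FP C)
    (h : ∀ i, representables C (A i)) : (representables C).isoClosure (∐ A) := by
  choose c hc using fun i ↦ (ObjectProperty.ofObj_iff _ _).1 (h i)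
  obtain rfl : (fun i ↦ (yonedaFP C).obj (c i)) = A := funext hc
  have : PreservesFiniteCoproducts (yonedaFP C) :=
    preservesFiniteCoproducts_leftOp (yonedaFP C).rightOp
  exact ⟨_, ⟨_⟩, ⟨(PreservesCoproduct.iso (yonedaFP C) c).symm⟩⟩

/-- A retract of `Y c` gives an idempotent of `Y c`, which comes from `C` because `Y` is fully
faithful. The image under `Y` of its splitting is another splitting of the same idempotent, hence
isomorphic to `X`. -/
lemma mem_isoClosure_representables [IsIdempotentComplete C] {X : FP C}
    (hX : isFiniteProjective (FP C) X) : (representables C).isoClosure X := by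
  have := isFinitaryQuasivarietyWith_representables (C := C) |>.small
  obtain ⟨ι, _, A, hA, ⟨r⟩⟩ := exists_retract_sigma isStrongGenerator_representables hX
  obtain ⟨_, ⟨c⟩, ⟨e⟩⟩ := exists_iso_sigma_yoneda A hA
  let r' : Retract X ((yonedaFP C).obj c) := r.trans (.ofIso e)
  have : IsIdempotentComplete Cᵒᵖ := Idempotents.isIdempotentComplete_iff_opposite.2 inferInstance
  obtain ⟨Y, i, p, h₁, h₂⟩ := IsIdempotentComplete.idempotents_split c
    ((yonedaFP C).preimage (r'.r ≫ r'.i)) ((yonedaFP C).map_injective (by simp))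
  have h₁' := congrArg (yonedaFP C).map h₁
  have h₂' := congrArg (yonedaFP C).map h₂
  simp only [Functor.map_comp, Functor.map_preimage] at h₁' h₂'
  replace h₁' := h₁'.trans ((yonedaFP C).map_id Y)
  refine ⟨_, ⟨Y⟩, ⟨⟨r'.i ≫ (yonedaFP C).map p, (yonedaFP C).map i ≫ r'.r, ?_, ?_⟩⟩⟩
  · rw [Category.assoc, reassoc_of% h₂', r'.retract, Category.comp_id, r'.retract]
  · rw [Category.assoc, ← reassoc_of% h₂', h₁']
    exact (Category.comp_id _).trans h₁'

end FPFunctor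

/-! ### Inducing a symmetric monoidal structure along a fully faithful functor -/

namespace SymMonStr

/-- A functor, regarded as a functor defined on `C` with the structure `S`. -/
def onCarrier {C : Type w} [Category.{v} C] {K : Type w'} [Category.{v'} K] (S : SymMonStr C)
    (J : C ⥤ K) : S.Carrier ⥤ K := J

section Induced

variable {C : Type w} [Category.{v} C] {K : Type w'} [Category.{v'} K] [MonoidalCategory K]
  [SymmetricCategory K] (J : C ⥤ K) [J.Full] [J.Faithful] {I : C} (e : 𝟙_ K ≅ J.obj I)
  {t : C → C → C} (m : ∀ a b, J.obj a ⊗ J.obj b ≅ J.obj (t a b))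

/-- The monoidal operations on a full subcategory which contains the unit and is closed under
tensor products. -/
@[reducible]
noncomputable def inducedStruct : MonoidalCategoryStruct C where
  tensorObj := t
  whiskerLeft X _ _ f := J.preimage ((m _ _).inv ≫ (J.obj X ◁ J.map f) ≫ (m _ _).hom)
  whiskerRight f X := J.preimage ((m _ _).inv ≫ (J.map f ▷ J.obj X) ≫ (m _ _).hom)
  tensorHom f g := J.preimage ((m _ _).inv ≫ (J.map f ⊗ₘ J.map g) ≫ (m _ _).hom)
  tensorUnit := I
  associator X Y Z := J.preimageIso
    ((((m _ _).symm ≪≫ ((m _ _).symm ⊗ᵢ .refl _))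
        ≪≫ α_ (J.obj X) (J.obj Y) (J.obj Z)
        ≪≫ ((.refl _ ⊗ᵢ m _ _) ≪≫ m _ _)))
  leftUnitor X := J.preimageIso (((m _ _).symm ≪≫ (e.symm ⊗ᵢ .refl _)) ≪≫ λ_ (J.obj X))
  rightUnitor X := J.preimageIso (((m _ _).symm ≪≫ (.refl _ ⊗ᵢ e.symm)) ≪≫ ρ_ (J.obj X))

@[reducible]
noncomputable def inducedData :
    letI := inducedStruct J e m
    Monoidal.InducingFunctorData J :=
  letI := inducedStruct J e m
  { μIso := m
    εIso := e
    whiskerLeft_eq _ _ _ _ := J.map_preimage _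
    whiskerRight_eq _ _ := J.map_preimage _
    tensorHom_eq _ _ := J.map_preimage _
    associator_eq _ _ _ := J.map_preimage _
    leftUnitor_eq _ := J.map_preimage _
    rightUnitor_eq _ := J.map_preimage _ }

/-- No coherence is asked of `e` and `m`: the operations on `C` are defined by conjugation with
them, and the axioms follow from those of `K` by faithfulness. -/
theorem exists_induced {I : C} (e : 𝟙_ K ≅ J.obj I) {t : C → C → C}
    (m : ∀ a b, J.obj a ⊗ J.obj b ≅ J.obj (t a b)) :
    ∃ S : SymMonStr C, Nonempty (S.onCarrier J).Braided := by
  let := inducedStruct J e m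
  let : MonoidalCategory C := Monoidal.induced J (inducedData J e m)
  let : J.Monoidal := Monoidal.fromInducedMonoidal J (inducedData J e m)
  let : BraidedCategory C := BraidedCategory.ofFullyFaithful J
  let : J.Braided := {
    braided X Y := by
      simp +instances [this, BraidedCategory.ofFullyFaithful, BraidedCategory.ofFaithful] }
  exact ⟨⟨inferInstance, .ofFaithful J⟩, ⟨this⟩⟩

end Induced

instance {K : Type w} [Category.{v} K] [MonoidalCategory K] [SymmetricCategory K] :
    SymmetricCategory Kᵒᵖ where
  symmetry X Y := Quiver.Hom.unop_inj (by simp)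

/-- The functor `Cᵒᵖ ⥤ D` of a strong monoidal functor `C ⥤ Dᵒᵖ` is strong monoidal. -/
@[reducible]
def leftOpMonoidal {C : Type*} {D : Type*} [Category* C] [Category* D] [MonoidalCategory C]
    [MonoidalCategory D] (F : C ⥤ Dᵒᵖ) [F.Monoidal] : F.leftOp.Monoidal where
  ε := (Functor.OplaxMonoidal.η F).unop
  μ X Y := (Functor.OplaxMonoidal.δ F X.unop Y.unop).unop
  η := (Functor.LaxMonoidal.ε F).unop
  δ X Y := (Functor.LaxMonoidal.μ F X.unop Y.unop).unop
  μ_natural_left f X := Quiver.Hom.op_inj (by simp)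
  μ_natural_right X f := Quiver.Hom.op_inj (by simp)
  associativity X Y Z := Quiver.Hom.op_inj (by simp)
  left_unitality X := Quiver.Hom.op_inj (by simp)
  right_unitality X := Quiver.Hom.op_inj (by simp)
  δ_natural_left f X := Quiver.Hom.op_inj (by simp)
  δ_natural_right X f := Quiver.Hom.op_inj (by simp)
  oplax_associativity X Y Z := Quiver.Hom.op_inj (by simp)
  oplax_left_unitality X := Quiver.Hom.op_inj (by simp)
  oplax_right_unitality X := Quiver.Hom.op_inj (by simp)
  ε_η := Quiver.Hom.op_inj (by simp)
  η_ε := Quiver.Hom.op_inj (by simp)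
  μ_δ X Y := Quiver.Hom.op_inj (by simp)
  δ_μ X Y := Quiver.Hom.op_inj (by simp)

@[reducible]
def leftOpBraided {C : Type*} {D : Type*} [Category* C] [Category* D] [MonoidalCategory C]
    [MonoidalCategory D] [BraidedCategory C] [BraidedCategory D] (F : C ⥤ Dᵒᵖ) [F.Braided] :
    F.leftOp.Braided where
  toMonoidal := leftOpMonoidal F
  braided X Y := by
    have h := congrArg Quiver.Hom.unop (Functor.map_braiding F Y.unop X.unop)
    exact Quiver.Hom.op_inj (by
      simp [Functor.LaxMonoidal.μ])

end SymMonStr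

/-! ### Restricting a structure on `FP C` to `C` -/

namespace FPFunctor

open FiniteProjective

variable {C : Type u} [SmallCategory C] [HasFiniteProducts C] [IsIdempotentComplete C]

/-- A symmetric monoidal finitary variety structure with projective unit on `FP C` restricts to the
representable functors. -/
theorem exists_braided_yonedaStr (T : SymMonStr (FP C)) (hT : isSMFVWithProjectiveUnit (FP C) T) :
    ∃ S : SymMonStr C, Nonempty (yonedaStr S T).Braided := by
  have h₀ : (representables C).isoClosure (𝟙_ T.Carrier) :=
    mem_isoClosure_representables ⟨hT.1.unit_isFinitelyPresentable, hT.2⟩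
  obtain ⟨_, ⟨I⟩, ⟨e⟩⟩ := h₀
  have h₂ (a b : C) : ∃ c : C, Nonempty ((show T.Carrier from (yonedaFP C).obj (.op a)) ⊗
      (show T.Carrier from (yonedaFP C).obj (.op b)) ≅
      (show T.Carrier from (yonedaFP C).obj (.op c))) := by
    obtain ⟨_, ⟨c⟩, ⟨i⟩⟩ := mem_isoClosure_representables (isFiniteProjective_tensor hT.1
      (isFinitaryQuasivarietyWith_representables.le_isFiniteProjective _ ⟨.op a⟩)
      (isFinitaryQuasivarietyWith_representables.le_isFiniteProjective _ ⟨.op b⟩))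
    exact ⟨c.unop, ⟨i⟩⟩
  choose t m using h₂
  -- Yoneda is contravariant, so the structure is induced along its covariant form with values in
  -- the opposite category.
  let J : C ⥤ (T.Carrier)ᵒᵖ := (yonedaFP C).rightOp
  have : J.Full := inferInstanceAs (yonedaFP C).rightOp.Full
  have : J.Faithful := inferInstanceAs (yonedaFP C).rightOp.Faithful
  obtain ⟨S, ⟨hS⟩⟩ := SymMonStr.exists_induced J (I := I.unop) (t := t) (Iso.op (show
    (show T.Carrier from (yonedaFP C).obj I) ≅ 𝟙_ T.Carrier from e.symm))
    (fun a b ↦ Iso.op (m a b).some.symm)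
  exact ⟨S, ⟨SymMonStr.leftOpBraided (S.onCarrier J)⟩⟩

end FPFunctor

/-! ### Dense functors and maps out of tensor products -/

/-- A functor `J : A ⥤ K` is dense: morphisms `F ⟶ G` correspond to natural families of maps
from the morphisms `J a ⟶ F` to the morphisms `J a ⟶ G`. -/
structure IsDenseFunctor {A : Type*} {K : Type*} [Category* A] [Category* K] (J : A ⥤ K) :
    Prop where
  hom_ext : ∀ {F G : K} {u v : F ⟶ G}, (∀ a (x : J.obj a ⟶ F), x ≫ u = x ≫ v) → u = v
  exists_hom : ∀ {F G : K} (φ : ∀ a, (J.obj a ⟶ F) → (J.obj a ⟶ G)),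
    (∀ a b (p : a ⟶ b) (x : J.obj b ⟶ F), J.map p ≫ φ b x = φ a (J.map p ≫ x)) →
    ∃ h : F ⟶ G, ∀ a x, x ≫ h = φ a x

namespace IsDenseFunctor

variable {A : Type*} {K : Type*} [Category* A] [Category* K] {J : A ⥤ K}
  [MonoidalCategory K] [MonoidalClosed K] (hJ : IsDenseFunctor J)

include hJ

/-- Currying moves `F` into the target, after which density applies to `G` alone; the braiding gives
the other variable. -/
lemma hom_ext_left {F G H : K} {u v : F ⊗ G ⟶ H}
    (h : ∀ b (y : J.obj b ⟶ G), F ◁ y ≫ u = F ◁ y ≫ v) : u = v := by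
  apply MonoidalClosed.curry_injective
  apply hJ.hom_ext
  intro b y
  rw [← MonoidalClosed.curry_natural_left, ← MonoidalClosed.curry_natural_left, h]

lemma exists_hom_left {F G H : K} (φ : ∀ b, (J.obj b ⟶ G) → (F ⊗ J.obj b ⟶ H))
    (hφ : ∀ a b (p : a ⟶ b) (y : J.obj b ⟶ G), F ◁ J.map p ≫ φ b y = φ a (J.map p ≫ y)) :
    ∃ h : F ⊗ G ⟶ H, ∀ b y, F ◁ y ≫ h = φ b y := by
  obtain ⟨h, hh⟩ := hJ.exists_hom (fun b y ↦ MonoidalClosed.curry (φ b y)) (fun a b p y ↦ by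
    rw [← MonoidalClosed.curry_natural_left, hφ])
  refine ⟨MonoidalClosed.uncurry h, fun b y ↦ ?_⟩
  apply MonoidalClosed.curry_injective
  rw [MonoidalClosed.curry_natural_left, MonoidalClosed.curry_uncurry, hh]

variable [BraidedCategory K]

lemma hom_ext_right {F G H : K} {u v : F ⊗ G ⟶ H}
    (h : ∀ a (x : J.obj a ⟶ F), x ▷ G ≫ u = x ▷ G ≫ v) : u = v := by
  rw [← cancel_epi (β_ G F).hom]
  apply hJ.hom_ext_left
  intro a x
  rw [BraidedCategory.braiding_naturality_right_assoc, h,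
    BraidedCategory.braiding_naturality_right_assoc]

lemma exists_hom_right {F G H : K} (φ : ∀ a, (J.obj a ⟶ F) → (J.obj a ⊗ G ⟶ H))
    (hφ : ∀ a b (p : a ⟶ b) (x : J.obj b ⟶ F), J.map p ▷ G ≫ φ b x = φ a (J.map p ≫ x)) :
    ∃ h : F ⊗ G ⟶ H, ∀ a x, x ▷ G ≫ h = φ a x := by
  obtain ⟨h, hh⟩ := hJ.exists_hom_left (fun a x ↦ (β_ (J.obj a) G).inv ≫ φ a x)
    (fun a b p x ↦ by rw [BraidedCategory.braiding_inv_naturality_right_assoc, hφ])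
  refine ⟨(β_ F G).hom ≫ h, fun a x ↦ ?_⟩
  rw [BraidedCategory.braiding_naturality_left_assoc, hh, Iso.hom_inv_id_assoc]

lemma hom_ext₂ {F G H : K} {u v : F ⊗ G ⟶ H}
    (h : ∀ a b (x : J.obj a ⟶ F) (y : J.obj b ⟶ G), (x ⊗ₘ y) ≫ u = (x ⊗ₘ y) ≫ v) : u = v := by
  apply hJ.hom_ext_left
  intro b y
  apply hJ.hom_ext_right
  intro a x
  rw [← tensorHom_def_assoc, ← tensorHom_def_assoc, h]

lemma hom_ext₃ {F G H M : K} {u v : (F ⊗ G) ⊗ H ⟶ M}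
    (h : ∀ a b c (x : J.obj a ⟶ F) (y : J.obj b ⟶ G) (z : J.obj c ⟶ H),
      ((x ⊗ₘ y) ⊗ₘ z) ≫ u = ((x ⊗ₘ y) ⊗ₘ z) ≫ v) : u = v := by
  apply hJ.hom_ext_left
  intro c z
  -- The braiding puts `F ⊗ G` in the variable that remains after currying, so that the two-variable
  -- case applies.
  rw [← cancel_epi (β_ (J.obj c) (F ⊗ G)).hom]
  apply MonoidalClosed.curry_injective
  apply hJ.hom_ext₂
  intro a b x y
  rw [← MonoidalClosed.curry_natural_left, ← MonoidalClosed.curry_natural_left,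
    BraidedCategory.braiding_naturality_right_assoc, ← tensorHom_def_assoc, h,
    BraidedCategory.braiding_naturality_right_assoc, ← tensorHom_def_assoc]

/-- Density is used one variable at a time: first for fixed `y`, then in `y`, where naturality of
the intermediate maps is checked by `hom_ext_right`. -/
lemma exists_hom₂ {F G H : K}
    (φ : ∀ a b, (J.obj a ⟶ F) → (J.obj b ⟶ G) → (J.obj a ⊗ J.obj b ⟶ H))
    (hφ : ∀ a a' b (p : a ⟶ a') (x : J.obj a' ⟶ F) (y : J.obj b ⟶ G),
      J.map p ▷ _ ≫ φ a' b x y = φ a b (J.map p ≫ x) y)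
    (hφ' : ∀ a b b' (p : b ⟶ b') (x : J.obj a ⟶ F) (y : J.obj b' ⟶ G),
      _ ◁ J.map p ≫ φ a b' x y = φ a b x (J.map p ≫ y)) :
    ∃ h : F ⊗ G ⟶ H, ∀ a b x y, (x ⊗ₘ y) ≫ h = φ a b x y := by
  choose h hh using fun b (y : J.obj b ⟶ G) ↦ hJ.exists_hom_right (fun a x ↦ φ a b x y)
    (fun a a' p x ↦ hφ a a' b p x y)
  obtain ⟨k, hk⟩ := hJ.exists_hom_left h (fun b b' p y ↦ by
    apply hJ.hom_ext_right
    intro a x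
    rw [← whisker_exchange_assoc, hh, hh, hφ'])
  refine ⟨k, fun a b x y ↦ ?_⟩
  rw [tensorHom_def_assoc, hk, hh]

end IsDenseFunctor

/-! ### Extending strong monoidal structures from a dense subcategory -/

open Functor.LaxMonoidal Functor.OplaxMonoidal

section Extension

variable {A : Type*} {K : Type*} {K' : Type*} [Category* A] [Category* K] [Category* K']
  [MonoidalCategory A] [MonoidalCategory K] [MonoidalCategory K'] [BraidedCategory A]
  [BraidedCategory K] [BraidedCategory K'] (J : A ⥤ K) (Φ : K ⥤ K') [J.Braided]
  [(J ⋙ Φ).Braided]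

/-- The values on representables of the tensor structure of an extension. -/
def extensionValue {F G : K} {a b : A} (x : J.obj a ⟶ F) (y : J.obj b ⟶ G) :
    Φ.obj (J.obj a) ⊗ Φ.obj (J.obj b) ⟶ Φ.obj (F ⊗ G) :=
  μ (J ⋙ Φ) a b ≫ Φ.map (δ J a b ≫ (x ⊗ₘ y))

lemma extensionValue_comp {F G F' G' : K} {a b : A} (x : J.obj a ⟶ F) (y : J.obj b ⟶ G)
    (f : F ⟶ F') (g : G ⟶ G') :
    extensionValue J Φ x y ≫ Φ.map (f ⊗ₘ g) = extensionValue J Φ (x ≫ f) (y ≫ g) := by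
  simp [extensionValue, ← Functor.map_comp]

lemma comp_extensionValue {F G : K} {a b a' b' : A} (x : J.obj a ⟶ F) (y : J.obj b ⟶ G)
    (p : a' ⟶ a) (q : b' ⟶ b) :
    (Φ.map (J.map p) ⊗ₘ Φ.map (J.map q)) ≫ extensionValue J Φ x y =
      extensionValue J Φ (J.map p ≫ x) (J.map q ≫ y) := by
  have h := μ_natural (J ⋙ Φ) p q
  dsimp only [Functor.comp_map] at h
  rw [extensionValue, reassoc_of% h, ← Φ.map_comp, ← δ_natural_assoc]
  simp [extensionValue]

variable [MonoidalClosed K] [MonoidalClosed K'] [Φ.Full] [Φ.Faithful]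
  (hJ : IsDenseFunctor J) (hP : IsDenseFunctor (J ⋙ Φ))

include hP in
-- Naturality forces this formula on maps from representables, and density turns it into a
-- definition. Full faithfulness of `Φ` identifies maps `Φ (J a) ⟶ Φ F` with maps `J a ⟶ F`.
theorem exists_extension_μ (F G : K) :
    ∃ m : Φ.obj F ⊗ Φ.obj G ⟶ Φ.obj (F ⊗ G),
      ∀ a b (x : J.obj a ⟶ F) (y : J.obj b ⟶ G),
        (Φ.map x ⊗ₘ Φ.map y) ≫ m = extensionValue J Φ x y := by
  have e₁ : ∀ {a a' : A} (p : a ⟶ a') {F : K} (x : Φ.obj (J.obj a') ⟶ Φ.obj F),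
      Φ.preimage (Φ.map (J.map p) ≫ x) = J.map p ≫ Φ.preimage x := fun p F x ↦
    Φ.map_injective (by simp)
  obtain ⟨m, hm⟩ := hP.exists_hom₂ (F := Φ.obj F) (G := Φ.obj G) (H := Φ.obj (F ⊗ G))
    (fun a b x y ↦ extensionValue J Φ (Φ.preimage x) (Φ.preimage y))
    (fun a a' b p x y ↦ by
      have := comp_extensionValue J Φ (Φ.preimage x) (Φ.preimage y) p (𝟙 b)
      simpa [e₁] using this)
    (fun a b b' p x y ↦ by
      have := comp_extensionValue J Φ (Φ.preimage x) (Φ.preimage y) (𝟙 a) p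
      simpa [e₁] using this)
  refine ⟨m, fun a b x y ↦ ?_⟩
  simpa using hm a b (Φ.map x) (Φ.map y)

section

variable {J Φ} (m : ∀ F G : K, Φ.obj F ⊗ Φ.obj G ⟶ Φ.obj (F ⊗ G))
  (hm : ∀ F G a b (x : J.obj a ⟶ F) (y : J.obj b ⟶ G),
    (Φ.map x ⊗ₘ Φ.map y) ≫ m F G = extensionValue J Φ x y)

omit [MonoidalClosed K] [MonoidalClosed K'] [Φ.Full] [Φ.Faithful] in
include hm in
lemma extension_rep (a b : A) : m (J.obj a) (J.obj b) = μ (J ⋙ Φ) a b ≫ Φ.map (δ J a b) := by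
  simpa [extensionValue] using hm _ _ a b (𝟙 _) (𝟙 _)

include hP hm

lemma extension_naturality {F G F' G' : K} (f : F ⟶ F') (g : G ⟶ G') :
    (Φ.map f ⊗ₘ Φ.map g) ≫ m F' G' = m F G ≫ Φ.map (f ⊗ₘ g) := by
  apply hP.hom_ext₂
  intro a b x y
  obtain ⟨x, rfl⟩ := Φ.map_surjective x
  obtain ⟨y, rfl⟩ := Φ.map_surjective y
  rw [reassoc_of% hm, extensionValue_comp, tensorHom_comp_tensorHom_assoc, ← Φ.map_comp,
    ← Φ.map_comp, hm]

lemma extension_naturality_left {F F' : K} (f : F ⟶ F') (G : K) :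
    Φ.map f ▷ Φ.obj G ≫ m F' G = m F G ≫ Φ.map (f ▷ G) := by
  simpa using extension_naturality hP m hm f (𝟙 G)

lemma extension_naturality_right {G G' : K} (F : K) (g : G ⟶ G') :
    Φ.obj F ◁ Φ.map g ≫ m F G' = m F G ≫ Φ.map (F ◁ g) := by
  simpa using extension_naturality hP m hm (𝟙 F) g

lemma extension_rep_comp (a b : A) :
    m (J.obj a) (J.obj b) ≫ Φ.map (μ J a b) = μ (J ⋙ Φ) a b := by
  rw [extension_rep m hm, Category.assoc, ← Φ.map_comp, Functor.Monoidal.δ_μ, Φ.map_id]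
  exact Category.comp_id _

/-- After composing with the invertible `μ J`, the equation becomes associativity of `J ⋙ Φ`
combined with that of `J`. -/
lemma extension_associativity_rep (a b c : A) :
    m (J.obj a) (J.obj b) ▷ Φ.obj (J.obj c) ≫ m _ _ ≫
      Φ.map (α_ (J.obj a) (J.obj b) (J.obj c)).hom =
    (α_ _ _ _).hom ≫ Φ.obj (J.obj a) ◁ m (J.obj b) (J.obj c) ≫ m _ _ := by
  rw [← cancel_mono (Φ.map (J.obj a ◁ μ J b c)), ← cancel_mono (Φ.map (μ J a (b ⊗ c)))]
  have h₁ := Functor.LaxMonoidal.associativity J a b c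
  have h₂ := Functor.LaxMonoidal.associativity (J ⋙ Φ) a b c
  have r := extension_rep_comp hP m hm
  have nl := extension_naturality_left hP m hm (μ J a b) (J.obj c)
  have nr := extension_naturality_right hP m hm (J.obj a) (μ J b c)
  simp only [Functor.comp_obj, Functor.comp_map] at h₂ r
  simp only [Category.assoc]
  rw [← Φ.map_comp, ← Φ.map_comp, ← h₁, Φ.map_comp, Φ.map_comp, ← reassoc_of% nl,
    ← comp_whiskerRight_assoc, r, reassoc_of% (r (a ⊗ b) c), h₂,
    Φ.map_comp, ← reassoc_of% nr, ← whiskerLeft_comp_assoc, r, r]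

/-- By density in three variables and naturality of `m`, the general case follows from the case of
representables. -/
lemma extension_associativity (F G H : K) :
    m F G ▷ Φ.obj H ≫ m (F ⊗ G) H ≫ Φ.map (α_ F G H).hom =
      (α_ _ _ _).hom ≫ Φ.obj F ◁ m G H ≫ m F (G ⊗ H) := by
  apply hP.hom_ext₃
  intro a b c x y z
  obtain ⟨x, rfl⟩ := Φ.map_surjective x
  obtain ⟨y, rfl⟩ := Φ.map_surjective y
  obtain ⟨z, rfl⟩ := Φ.map_surjective z
  have h := congrArg (· ≫ Φ.map (x ⊗ₘ (y ⊗ₘ z))) (extension_associativity_rep hP m hm a b c)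
  have n₁ := extension_naturality hP m hm (x ⊗ₘ y) z
  have n₂ := extension_naturality hP m hm x (y ⊗ₘ z)
  have n₃ := extension_naturality hP m hm x y
  have n₄ := extension_naturality hP m hm y z
  simp only [Category.assoc] at h
  rw [← Φ.map_comp, ← associator_naturality, Φ.map_comp, ← reassoc_of% n₁, ← n₂] at h
  have e₁ : ((Φ.map x ⊗ₘ Φ.map y) ⊗ₘ Φ.map z) ≫ m F G ▷ Φ.obj H =
      m (J.obj a) (J.obj b) ▷ Φ.obj (J.obj c) ≫ (Φ.map (x ⊗ₘ y) ⊗ₘ Φ.map z) := by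
    rw [tensorHom_comp_whiskerRight, n₃, whiskerRight_comp_tensorHom]
  have e₂ : (Φ.map x ⊗ₘ (Φ.map y ⊗ₘ Φ.map z)) ≫ Φ.obj F ◁ m G H =
      Φ.obj (J.obj a) ◁ m (J.obj b) (J.obj c) ≫ (Φ.map x ⊗ₘ Φ.map (y ⊗ₘ z)) := by
    rw [tensorHom_comp_whiskerLeft, n₄, whiskerLeft_comp_tensorHom]
  dsimp only [Functor.comp_obj]
  rw [reassoc_of% e₁, h, associator_naturality_assoc, reassoc_of% e₂]

lemma extension_left_unitality (F : K) :
    (λ_ (Φ.obj F)).hom =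
      (ε (J ⋙ Φ) ≫ Φ.map (η J)) ▷ Φ.obj F ≫ m (𝟙_ K) F ≫ Φ.map (λ_ F).hom := by
  refine hP.hom_ext_left fun a x ↦ ?_
  obtain ⟨x, rfl⟩ := Φ.map_surjective x
  have h₁ := Functor.OplaxMonoidal.left_unitality_hom J a
  have h₂ := Functor.LaxMonoidal.left_unitality (J ⋙ Φ) a
  have n₁ := extension_naturality_left hP m hm (η J) (J.obj a)
  have n₂ := extension_naturality_right hP m hm (𝟙_ K) x
  dsimp only [Functor.comp_obj, Functor.comp_map] at h₁ h₂ ⊢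
  rw [leftUnitor_naturality, whisker_exchange_assoc, reassoc_of% n₂, ← Φ.map_comp,
    leftUnitor_naturality, Φ.map_comp, comp_whiskerRight_assoc, reassoc_of% n₁,
    extension_rep m hm, h₂]
  have h₁' := congrArg Φ.map h₁
  simp only [Φ.map_comp] at h₁'
  simp only [Category.assoc, reassoc_of% h₁']

lemma extension_right_unitality (F : K) :
    (ρ_ (Φ.obj F)).hom =
      Φ.obj F ◁ (ε (J ⋙ Φ) ≫ Φ.map (η J)) ≫ m F (𝟙_ K) ≫ Φ.map (ρ_ F).hom := by
  refine hP.hom_ext_right fun a x ↦ ?_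
  obtain ⟨x, rfl⟩ := Φ.map_surjective x
  have h₁ := Functor.OplaxMonoidal.right_unitality_hom J a
  have h₂ := Functor.LaxMonoidal.right_unitality (J ⋙ Φ) a
  have n₁ := extension_naturality_right hP m hm (J.obj a) (η J)
  have n₂ := extension_naturality_left hP m hm x (𝟙_ K)
  dsimp only [Functor.comp_obj, Functor.comp_map] at h₁ h₂ ⊢
  rw [rightUnitor_naturality, ← whisker_exchange_assoc, reassoc_of% n₂, ← Φ.map_comp,
    rightUnitor_naturality, Φ.map_comp, whiskerLeft_comp_assoc, reassoc_of% n₁,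
    extension_rep m hm, h₂]
  have h₁' := congrArg Φ.map h₁
  simp only [Φ.map_comp] at h₁'
  simp only [Category.assoc, reassoc_of% h₁']

lemma extension_braided (F G : K) :
    m F G ≫ Φ.map (β_ F G).hom = (β_ _ _).hom ≫ m G F := by
  apply hP.hom_ext₂
  intro a b x y
  obtain ⟨x, rfl⟩ := Φ.map_surjective x
  obtain ⟨y, rfl⟩ := Φ.map_surjective y
  have h₁ : δ J a b ≫ (β_ (J.obj a) (J.obj b)).hom = J.map (β_ a b).hom ≫ δ J b a := by simp
  have h₂ := Functor.LaxBraided.braided (F := J ⋙ Φ) a b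
  have n₁ := extension_naturality hP m hm x y
  have n₂ := extension_naturality hP m hm y x
  dsimp only [Functor.comp_obj, Functor.comp_map] at h₁ h₂ ⊢
  rw [reassoc_of% n₁, ← Φ.map_comp, BraidedCategory.braiding_naturality,
    BraidedCategory.braiding_naturality_assoc, n₂, extension_rep m hm,
    extension_rep m hm]
  have h₁' := congrArg Φ.map h₁
  simp only [Φ.map_comp] at h₁'
  simp only [Category.assoc, Φ.map_comp, reassoc_of% h₁', reassoc_of% h₂]

include hJ in
-- The inverse is built by density in `K`: on representables `m` is invertible, and essential
-- surjectivity supplies an object of `K` over `Φ F ⊗ Φ G` to serve as target.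
lemma extension_isIso [Φ.EssSurj] (F G : K) : IsIso (m F G) := by
  have hi : ∀ a b, IsIso (m (J.obj a) (J.obj b)) := fun a b ↦ by
    rw [extension_rep m hm]
    exact IsIso.comp_isIso' inferInstance inferInstance
  let i := Φ.objObjPreimageIso (Φ.obj F ⊗ Φ.obj G)
  obtain ⟨h, hh⟩ := hJ.exists_hom₂ (F := F) (G := G)
    (fun a b x y ↦ Φ.preimage (inv (m (J.obj a) (J.obj b)) ≫ (Φ.map x ⊗ₘ Φ.map y) ≫ i.inv))
    (fun a a' b p x y ↦ by
      apply Φ.map_injective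
      rw [← cancel_epi (m _ _), Φ.map_comp, ← reassoc_of% extension_naturality_left hP m hm]
      simp [whiskerRight_comp_tensorHom_assoc])
    (fun a b b' p x y ↦ by
      apply Φ.map_injective
      rw [← cancel_epi (m _ _), Φ.map_comp, ← reassoc_of% extension_naturality_right hP m hm]
      simp [whiskerLeft_comp_tensorHom_assoc])
  have hν : ∀ a b (x : J.obj a ⟶ F) (y : J.obj b ⟶ G), Φ.map (x ⊗ₘ y) ≫ Φ.map h ≫ i.hom =
      inv (m (J.obj a) (J.obj b)) ≫ (Φ.map x ⊗ₘ Φ.map y) := fun a b x y ↦ by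
    rw [← Φ.map_comp_assoc, hh, Φ.map_preimage]
    simp
  refine ⟨Φ.map h ≫ i.hom, ?_, ?_⟩
  · apply hP.hom_ext₂
    intro a b x y
    obtain ⟨x, rfl⟩ := Φ.map_surjective x
    obtain ⟨y, rfl⟩ := Φ.map_surjective y
    have n := extension_naturality hP m hm x y
    dsimp only [Functor.comp_obj]
    rw [reassoc_of% n, hν, IsIso.hom_inv_id_assoc, Category.comp_id]
  · obtain ⟨w, hw⟩ := Φ.map_surjective ((Φ.map h ≫ i.hom) ≫ m F G)
    rw [← hw, ← Φ.map_id]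
    refine congrArg Φ.map (hJ.hom_ext₂ fun a b x y ↦ Φ.map_injective ?_)
    rw [Φ.map_comp, hw, Category.assoc, reassoc_of% hν, extension_naturality hP m hm x y]
    simp

end

include hJ hP in
/-- A strong monoidal structure on the restriction to a dense subcategory extends. -/
theorem exists_extension [Φ.EssSurj] (e : 𝟙_ K' ⟶ Φ.obj (J.obj (𝟙_ A))) (he : ε (J ⋙ Φ) = e)
    (t : ∀ a b, Φ.obj (J.obj a) ⊗ Φ.obj (J.obj b) ⟶ Φ.obj (J.obj (a ⊗ b)))
    (ht : ∀ a b, μ (J ⋙ Φ) a b = t a b) : ∃ _ : Φ.Braided,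
    ε Φ = e ≫ Φ.map (η J) ∧ ∀ a b, μ Φ (J.obj a) (J.obj b) = t a b ≫ Φ.map (δ J a b) := by
  choose m hm using exists_extension_μ J Φ hP
  have hε : IsIso (ε (J ⋙ Φ) ≫ Φ.map (η J)) := IsIso.comp_isIso' inferInstance inferInstance
  let _ : Φ.LaxMonoidal :=
    { ε := ε (J ⋙ Φ) ≫ Φ.map (η J)
      μ := m
      μ_natural_left := extension_naturality_left hP m hm
      μ_natural_right := extension_naturality_right hP m hm
      associativity := extension_associativity hP m hm
      left_unitality := extension_left_unitality hP m hm
      right_unitality := extension_right_unitality hP m hm }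
  have : IsIso (ε Φ) := hε
  have : ∀ F G, IsIso (μ Φ F G) := fun F G ↦ extension_isIso hJ hP m hm F G
  let _ : Φ.Monoidal := Functor.Monoidal.ofLaxMonoidal Φ
  refine ⟨{ braided := extension_braided hP m hm }, ?_, fun a b ↦ ?_⟩
  · subst he
    rfl
  · exact (extension_rep m hm a b).trans (congrArg (· ≫ _) (ht a b))

omit [MonoidalCategory A] [BraidedCategory A] [MonoidalClosed K] [J.Braided] [(J ⋙ Φ).Braided]
  [Φ.Faithful] in
include hP in
-- Naturality expresses `μ` on maps from representables through its values there, and density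
-- detects equality.
theorem extension_unique (h h' : Φ.Braided)
    (hμ : ∀ a b, h.μ (J.obj a) (J.obj b) = h'.μ (J.obj a) (J.obj b))
    (F G : K) : h.μ F G = h'.μ F G := by
  apply hP.hom_ext₂
  intro a b x y
  obtain ⟨x, rfl⟩ := Φ.map_surjective x
  obtain ⟨y, rfl⟩ := Φ.map_surjective y
  have e₁ := @μ_natural _ _ _ _ _ _ Φ h.toLaxMonoidal _ _ _ _ x y
  have e₂ := @μ_natural _ _ _ _ _ _ Φ h'.toLaxMonoidal _ _ _ _ x y
  refine e₁.trans (Eq.trans ?_ e₂.symm)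
  exact congrArg (· ≫ Φ.map (x ⊗ₘ y)) (hμ a b)

end Extension

/-! ### Restricting strong monoidal structures along a fully faithful functor -/

section Restriction

variable {A : Type*} {A' : Type*} {K : Type*} [Category* A] [Category* A'] [Category* K]
  [MonoidalCategory A] [MonoidalCategory A'] [MonoidalCategory K] [BraidedCategory A]
  [BraidedCategory A'] [BraidedCategory K]

/-- A functor whose composite with a fully faithful strong monoidal functor is strong monoidal is
itself strong monoidal. -/
theorem exists_restriction (Ψ : A ⥤ A') (Q : A' ⥤ K) [Q.Braided] [(Ψ ⋙ Q).Braided] [Q.Full]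
    [Q.Faithful] (e : 𝟙_ K ⟶ Q.obj (Ψ.obj (𝟙_ A))) (he : ε (Ψ ⋙ Q) = e)
    (t : ∀ a b, Q.obj (Ψ.obj a) ⊗ Q.obj (Ψ.obj b) ⟶ Q.obj (Ψ.obj (a ⊗ b)))
    (ht : ∀ a b, μ (Ψ ⋙ Q) a b = t a b) : ∃ _ : Ψ.Braided,
    Q.map (ε Ψ) = η Q ≫ e ∧ ∀ a b, Q.map (μ Ψ a b) = δ Q (Ψ.obj a) (Ψ.obj b) ≫ t a b := by
  have hε : IsIso (Q.preimage (η Q ≫ ε (Ψ ⋙ Q))) := by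
    rw [← isIso_iff_of_reflects_iso _ Q, Q.map_preimage]
    exact IsIso.comp_isIso' inferInstance inferInstance
  have hμ : ∀ a b, IsIso (Q.preimage (δ Q (Ψ.obj a) (Ψ.obj b) ≫ μ (Ψ ⋙ Q) a b)) := fun a b ↦ by
    rw [← isIso_iff_of_reflects_iso _ Q, Q.map_preimage]
    exact IsIso.comp_isIso' inferInstance inferInstance
  have hb : ∀ a b, Q.map (Q.preimage (δ Q (Ψ.obj a) (Ψ.obj b) ≫ μ (Ψ ⋙ Q) a b)) ≫
      Q.map (Ψ.map (β_ a b).hom) = Q.map (β_ _ _).hom ≫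
        Q.map (Q.preimage (δ Q (Ψ.obj b) (Ψ.obj a) ≫ μ (Ψ ⋙ Q) b a)) := fun a b ↦ by
    have h := Functor.LaxBraided.braided (F := Ψ ⋙ Q) a b
    dsimp only [Functor.comp_obj, Functor.comp_map] at h
    simp [h]
  -- The structure maps of `Ψ ⋙ Q`, corrected by the inverse ones of `Q`, lift along `Q`; each axiom
  -- is checked after applying `Q`.
  let _ : Ψ.LaxMonoidal :=
    { ε := Q.preimage (η Q ≫ ε (Ψ ⋙ Q))
      μ a b := Q.preimage (δ Q _ _ ≫ μ (Ψ ⋙ Q) a b)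
      μ_natural_left f X := Q.map_injective (by
        have h := μ_natural_left (Ψ ⋙ Q) f X
        dsimp only [Functor.comp_obj, Functor.comp_map] at h
        simp [← h])
      μ_natural_right X f := Q.map_injective (by
        have h := μ_natural_right (Ψ ⋙ Q) X f
        dsimp only [Functor.comp_obj, Functor.comp_map] at h
        simp [← h])
      associativity X Y Z := Q.map_injective (by
        have h := Functor.LaxMonoidal.associativity (Ψ ⋙ Q) X Y Z
        have h' := Functor.OplaxMonoidal.associativity Q (Ψ.obj X) (Ψ.obj Y) (Ψ.obj Z)
        dsimp only [Functor.comp_obj, Functor.comp_map] at h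
        simp only [Q.map_comp, Q.map_preimage, ← δ_natural_left_assoc, ← δ_natural_right_assoc,
          comp_whiskerRight, whiskerLeft_comp, Category.assoc, h, reassoc_of% h'])
      left_unitality X := Q.map_injective (by
        have h := Functor.LaxMonoidal.left_unitality (Ψ ⋙ Q) X
        have h' := Functor.OplaxMonoidal.left_unitality_hom Q (Ψ.obj X)
        dsimp only [Functor.comp_obj, Functor.comp_map] at h
        simp only [Q.map_comp, Q.map_preimage, ← δ_natural_left_assoc,
          comp_whiskerRight, Category.assoc, ← h, h'])
      right_unitality X := Q.map_injective (by
        have h := Functor.LaxMonoidal.right_unitality (Ψ ⋙ Q) X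
        have h' := Functor.OplaxMonoidal.right_unitality_hom Q (Ψ.obj X)
        dsimp only [Functor.comp_obj, Functor.comp_map] at h
        simp only [Q.map_comp, Q.map_preimage, ← δ_natural_right_assoc,
          whiskerLeft_comp, Category.assoc, ← h, h']) }
  have : IsIso (ε Ψ) := hε
  have : ∀ F G, IsIso (μ Ψ F G) := hμ
  let _ : Ψ.Monoidal := Functor.Monoidal.ofLaxMonoidal Ψ
  refine ⟨{ braided a b := Q.map_injective ((Q.map_comp _ _).trans ((hb a b).trans (Q.map_comp _ _).symm)) }, ?_, fun a b ↦ ?_⟩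
  · subst he
    exact Q.map_preimage _
  · rw [← ht]
    exact Q.map_preimage _

end Restriction

/-! ### Strong monoidal functors and opposites -/

section Opposite

variable {C : Type*} {D : Type*} [Category* C] [Category* D] [MonoidalCategory C]
    [MonoidalCategory D]

@[reducible]
def unopMonoidal (F : C ⥤ D) [F.op.Monoidal] : F.Monoidal where
  ε := (η F.op).unop
  μ X Y := (δ F.op (.op X) (.op Y)).unop
  η := (ε F.op).unop
  δ X Y := (μ F.op (.op X) (.op Y)).unop
  μ_natural_left f X := Quiver.Hom.op_inj (by simpa using δ_natural_left F.op f.op (.op X))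
  μ_natural_right X f := Quiver.Hom.op_inj (by simpa using δ_natural_right F.op (.op X) f.op)
  associativity X Y Z := Quiver.Hom.op_inj (by
    simpa using (Functor.OplaxMonoidal.associativity_inv F.op (.op X) (.op Y) (.op Z)).symm)
  left_unitality X := Quiver.Hom.op_inj (by
    simpa using Functor.OplaxMonoidal.left_unitality F.op (.op X))
  right_unitality X := Quiver.Hom.op_inj (by
    simpa using Functor.OplaxMonoidal.right_unitality F.op (.op X))
  δ_natural_left f X := Quiver.Hom.op_inj (by simpa using μ_natural_left F.op f.op (.op X))
  δ_natural_right X f := Quiver.Hom.op_inj (by simpa using μ_natural_right F.op (.op X) f.op)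
  oplax_associativity X Y Z := Quiver.Hom.op_inj (by
    simpa using (Functor.LaxMonoidal.associativity_inv F.op (.op X) (.op Y) (.op Z)).symm)
  oplax_left_unitality X := Quiver.Hom.op_inj (by
    simpa using Functor.LaxMonoidal.left_unitality F.op (.op X))
  oplax_right_unitality X := Quiver.Hom.op_inj (by
    simpa using Functor.LaxMonoidal.right_unitality F.op (.op X))
  ε_η := Quiver.Hom.op_inj (by simp)
  η_ε := Quiver.Hom.op_inj (by simp)
  μ_δ X Y := Quiver.Hom.op_inj (by simp)
  δ_μ X Y := Quiver.Hom.op_inj (by simp)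

variable [BraidedCategory C] [BraidedCategory D]

@[reducible]
def unopBraided (F : C ⥤ D) [F.op.Braided] : F.Braided where
  toMonoidal := unopMonoidal F
  braided X Y := by
    have h := congrArg (· ≫ δ F.op (.op X) (.op Y))
      (Functor.map_braiding F.op (.op Y) (.op X))
    simp only [Category.assoc, Functor.Monoidal.μ_δ, Category.comp_id] at h
    exact congrArg Quiver.Hom.unop h

@[reducible]
def opBraided (F : C ⥤ D) [F.Braided] : F.op.Braided where
  toMonoidal := opMonoidal F
  braided X Y := Quiver.Hom.unop_inj (by
    exact (congrArg (· ≫ δ F _ _) (Functor.map_braiding F Y.unop X.unop)).trans (by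
      simp only [Category.assoc, Functor.Monoidal.μ_δ, Category.comp_id]
      rfl))

end Opposite

namespace SymMonStr

variable {C : Type w} [Category.{v} C] (S S' : SymMonStr C)

instance : (change S S').Full := inferInstanceAs (𝟭 C).Full
instance : (change S S').Faithful := inferInstanceAs (𝟭 C).Faithful
instance : (change S S').EssSurj := inferInstanceAs (𝟭 C).EssSurj

end SymMonStr

/-! ### Compatible morphisms of structures on `C` and on `FP C` -/

namespace FPFunctor

open SymMonStr

variable {C : Type u} [SmallCategory C]

instance (S : SymMonStr C) (T : SymMonStr (FP C)) : (yonedaStr S T).Full :=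
  inferInstanceAs (yonedaFP C).Full

instance (S : SymMonStr C) (T : SymMonStr (FP C)) : (yonedaStr S T).Faithful :=
  inferInstanceAs (yonedaFP C).Faithful

theorem isDenseFunctor_yonedaFP : IsDenseFunctor (yonedaFP C) where
  hom_ext h := hom_ext_yoneda fun c x ↦ h (.op c) x
  exists_hom {F G} φ hφ := by
    refine ⟨homMk (fun c z ↦ yonedaEquiv (φ (.op c) (yonedaEquiv.symm z))) ?_, fun c x ↦ ?_⟩
    · intro c d p x
      rw [← yonedaEquiv_map_comp, ← map_comp_yonedaEquiv_symm]
      exact congrArg yonedaEquiv (hφ (.op d) (.op c) p.op _).symm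
    · apply yonedaEquiv.injective
      exact congrArg (fun x ↦ yonedaEquiv (φ c x)) (yonedaEquiv.symm_apply_apply x)

theorem isDenseFunctor_yonedaStr (S : SymMonStr C) (T : SymMonStr (FP C)) :
    IsDenseFunctor (yonedaStr S T) := isDenseFunctor_yonedaFP (C := C)

theorem isDenseFunctor_yonedaStr_change (S : SymMonStr C) (T T' : SymMonStr (FP C)) :
    IsDenseFunctor (yonedaStr S T ⋙ change T T') := isDenseFunctor_yonedaFP (C := C)

variable {S S' : SymMonStr C} {T T' : SymMonStr (FP C)}

/-- As the transformation is the identity, monoidality reduces to a unit equation and a tensor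
equation on representables. All the structure maps in them are invertible, so `f` determines `g` on
representables and conversely. -/
theorem yonedaCompatible_iff (f : S ⟶ S') (g : T ⟶ T')
    (y : (yonedaStr S T).Braided) (y' : (yonedaStr S' T').Braided) :
    YonedaCompatible f g y y' ↔
      y'.ε ≫ (yonedaStr S' T').map f.braided.η.op = g.braided.ε ≫ (change T T').map y.ε ∧
      ∀ X Y : C, y'.μ (.op X) (.op Y) ≫ (yonedaStr S' T').map (f.braided.δ X Y).op =
        g.braided.μ ((yonedaStr S T).obj (.op X)) ((yonedaStr S T).obj (.op Y)) ≫
          (change T T').map (y.μ (.op X) (.op Y)) := by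
  have e (X Y : T'.Carrier) (m : X ⊗ Y ⟶ X ⊗ Y) (h : m = 𝟙 _) {Z} (k : X ⊗ Y ⟶ Z) :
      m ≫ k = k := by rw [h, Category.id_comp]
  constructor
  · intro h
    refine ⟨(Category.comp_id _).symm.trans h.unit, fun X Y ↦ ?_⟩
    exact (Category.comp_id _).symm.trans ((h.tensor (.op X) (.op Y)).trans
      (e _ _ _ (id_tensorHom_id _ _) _))
  · intro h
    let := f.braided
    let := g.braided
    let : (SymMonStr.change S S').op.Monoidal := opMonoidal _
    let τ : (SymMonStr.change S S').op ⋙ yonedaStr S' T' ⟶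
      yonedaStr S T ⋙ SymMonStr.change T T' := 𝟙 (yonedaFP C)
    exact show NatTrans.IsMonoidal τ from
      { unit := (Category.comp_id _).trans h.1
        tensor X Y := (Category.comp_id _).trans ((h.2 X.unop Y.unop).trans
          (e _ _ _ (id_tensorHom_id _ _) _).symm) }

/-- A morphism of structures on `C` extends along the Yoneda embedding. -/
theorem exists_yonedaCompatible_right [MonoidalClosed T.Carrier] [MonoidalClosed T'.Carrier]
    (f : S ⟶ S') (y : (yonedaStr S T).Braided) (y' : (yonedaStr S' T').Braided) :
    ∃ g : T ⟶ T', YonedaCompatible f g y y' := by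
  let := f.braided
  let : (change S S').op.Braided := opBraided _
  let : (yonedaStr S T ⋙ change T T').Braided :=
    inferInstanceAs ((change S S').op ⋙ yonedaStr S' T').Braided
  obtain ⟨g, h₁, h₂⟩ := exists_extension (yonedaStr S T) (change T T')
    (isDenseFunctor_yonedaStr S T) (isDenseFunctor_yonedaStr_change S T T')
    _ rfl _ (fun _ _ ↦ rfl)
  refine ⟨⟨g⟩, (yonedaCompatible_iff _ _ _ _).2 ⟨?_, fun X Y ↦ ?_⟩⟩
  · refine Eq.symm ((congrArg (· ≫ (change T T').map (ε (yonedaStr S T))) h₁).trans ?_)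
    rw [Category.assoc, ← Functor.map_comp, Functor.Monoidal.η_ε, CategoryTheory.Functor.map_id]
    exact Category.comp_id _
  · refine Eq.symm ((congrArg (· ≫ (change T T').map (μ (yonedaStr S T) (.op X) (.op Y)))
      (h₂ (.op X) (.op Y))).trans ?_)
    rw [Category.assoc, ← Functor.map_comp, Functor.Monoidal.δ_μ, CategoryTheory.Functor.map_id]
    exact Category.comp_id _

theorem yonedaCompatible_right_unique [MonoidalClosed T.Carrier] [MonoidalClosed T'.Carrier]
    (f : S ⟶ S') (g g' : T ⟶ T') (y : (yonedaStr S T).Braided) (y' : (yonedaStr S' T').Braided)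
    (h : YonedaCompatible f g y y') (h' : YonedaCompatible f g' y y') : g = g' := by
  rw [yonedaCompatible_iff] at h h'
  refine Hom.ext_of_lax ?_ ?_
  · rw [← cancel_mono ((change T T').map y.ε)]
    exact h.1.symm.trans h'.1
  · apply extension_unique (yonedaStr S T) (change T T')
      (isDenseFunctor_yonedaStr_change S T T')
    intro X Y
    rw [← cancel_mono ((change T T').map (y.μ X Y))]
    exact (h.2 X.unop Y.unop).symm.trans (h'.2 X.unop Y.unop)

/-- A morphism of structures on `FP C` restricts along the Yoneda embedding. -/
theorem exists_yonedaCompatible_left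
    (g : T ⟶ T') (y : (yonedaStr S T).Braided) (y' : (yonedaStr S' T').Braided) :
    ∃ f : S ⟶ S', YonedaCompatible f g y y' := by
  let := g.braided
  let : ((change S S').op ⋙ yonedaStr S' T').Braided :=
    inferInstanceAs (yonedaStr S T ⋙ change T T').Braided
  obtain ⟨f, h₁, h₂⟩ := exists_restriction (change S S').op (yonedaStr S' T')
    _ rfl _ (fun _ _ ↦ rfl)
  refine ⟨⟨unopBraided _⟩, (yonedaCompatible_iff _ _ _ _).2 ⟨?_, fun X Y ↦ ?_⟩⟩
  · refine (congrArg (ε (yonedaStr S' T') ≫ ·) h₁).trans ?_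
    exact (Category.assoc _ _ _).symm.trans
      ((congrArg (· ≫ _) (Functor.Monoidal.ε_η _)).trans (Category.id_comp _))
  · refine (congrArg (μ (yonedaStr S' T') (.op X) (.op Y) ≫ ·) (h₂ (.op X) (.op Y))).trans ?_
    exact (Category.assoc _ _ _).symm.trans
      ((congrArg (· ≫ _) (Functor.Monoidal.μ_δ _ _ _)).trans (Category.id_comp _))

theorem yonedaCompatible_left_unique
    (f f' : S ⟶ S') (g : T ⟶ T') (y : (yonedaStr S T).Braided) (y' : (yonedaStr S' T').Braided)
    (h : YonedaCompatible f g y y') (h' : YonedaCompatible f' g y y') : f = f' := by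
  rw [yonedaCompatible_iff] at h h'
  have h₁ : f.braided.η = f'.braided.η := by
    have := (cancel_epi y'.ε).1 (h.1.trans h'.1.symm)
    exact Quiver.Hom.op_inj ((yonedaStr S' T').map_injective this)
  have h₂ (X Y : S.Carrier) : f.braided.δ X Y = f'.braided.δ X Y := by
    have := (cancel_epi (y'.μ (.op X) (.op Y))).1 ((h.2 X Y).trans (h'.2 X Y).symm)
    exact Quiver.Hom.op_inj ((yonedaStr S' T').map_injective this)
  refine Hom.ext_of_lax ?_ fun X Y ↦ ?_
  · rw [← cancel_mono f.braided.η, f.braided.ε_η, h₁, f'.braided.ε_η]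
  · rw [← cancel_mono (f.braided.δ X Y), f.braided.μ_δ, h₂, f'.braided.μ_δ]


/-! ### The restricted tensor product preserves finite products -/

section PreservesProducts

open Opposite

variable [HasFiniteProducts C]

instance (S : SymMonStr C) (T : SymMonStr (FP C)) : PreservesFiniteProducts (yonedaStr S T).rightOp :=
  inferInstanceAs (PreservesFiniteProducts (yonedaFP C).rightOp)

/-- If the Yoneda embedding is strong monoidal to a closed structure, then the tensor product of `C`
preserves finite products. -/
theorem tensorPreservesFiniteProducts_of_braided (S : SymMonStr C) (T : SymMonStr (FP C))
    [MonoidalClosed T.Carrier] (y : (yonedaStr S T).Braided) :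
    tensorPreservesFiniteProducts C S := by
  have h (X : S.Carrier) : PreservesFiniteProducts (tensorLeft X) := by
    let J := (yonedaStr S T).rightOp
    let i : tensorLeft X ⋙ J ≅ J ⋙ (tensorLeft ((yonedaStr S T).obj (op X))).op :=
      NatIso.ofComponents (fun Y ↦ (Functor.Monoidal.μIso (yonedaStr S T) (op X) (op Y)).op)
        (fun {Y Z} f ↦ by
          refine Quiver.Hom.unop_inj ?_
          exact (μ_natural_right (yonedaStr S T) (op X) f.op).symm)
    have : J.Full := inferInstance
    have : PreservesFiniteProducts (tensorLeft X ⋙ J) :=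
      ⟨fun n ↦ preservesLimitsOfShape_of_natIso i.symm⟩
    exact ⟨fun n ↦ ⟨fun {K} ↦ preservesLimit_of_reflects_of_preserves _ J⟩⟩
  intro X
  refine ⟨h X, ?_⟩
  have := h X
  exact ⟨fun n ↦ preservesLimitsOfShape_of_natIso (BraidedCategory.tensorLeftIsoTensorRight X)⟩

end PreservesProducts

end FPFunctor

/-! ### Day convolution: bilinear families and their representing objects -/

namespace FPFunctor

open Opposite

section Shift

variable {C : Type u} [SmallCategory C]

/-- Precomposition with a functor which preserves finite products. -/
def shift (Θ : C ⥤ C) [PreservesFiniteProducts Θ] (H : FP C) : FP C :=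
  ⟨Θ ⋙ H.obj, by
    have := H.property
    exact comp_preservesFiniteProducts _ _⟩

end Shift

variable {C : Type u} [SmallCategory C]

lemma obj_map_comp {F : FP C} {a b c : C} (p : a ⟶ b) (q : b ⟶ c) (x : F.obj.obj a) :
    F.obj.map q (F.obj.map p x) = F.obj.map (p ≫ q) x :=
  (Functor.map_comp_apply F.obj p q x).symm

variable [MonoidalCategory C]

/-- Natural families of maps `F c × G d → H (c ⊗ d)`. -/
structure Bilinear (F G H : FP C) where
  app (c d : C) : F.obj.obj c → G.obj.obj d → H.obj.obj (c ⊗ d)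
  map_left {c c' : C} (d : C) (p : c ⟶ c') (x : F.obj.obj c) (y : G.obj.obj d) :
    app c' d (F.obj.map p x) y = H.obj.map (p ▷ d) (app c d x y)
  map_right (c : C) {d d' : C} (q : d ⟶ d') (x : F.obj.obj c) (y : G.obj.obj d) :
    app c d' x (G.obj.map q y) = H.obj.map (c ◁ q) (app c d x y)

lemma Bilinear.map {F G H : FP C} (φ : Bilinear F G H) {c c' d d' : C} (p : c ⟶ c') (q : d ⟶ d')
    (x : F.obj.obj c) (y : G.obj.obj d) :
    φ.app c' d' (F.obj.map p x) (G.obj.map q y) = H.obj.map (p ⊗ₘ q) (φ.app c d x y) := by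
  rw [φ.map_left, φ.map_right, ← Functor.map_comp_apply, ← tensorHom_def']

variable [HasFiniteProducts C]

/-- The object is the colimit in `FP C` of the representables `Y (c ⊗ d)` over pairs of elements of
`F` and `G`: by Yoneda a cocone is a bilinear family. Existence needs nothing from the tensor of `C`
beyond functoriality. -/
theorem exists_tensor (F G : FP C) : ∃ (T : FP C) (u : Bilinear F G T),
    ∀ (H : FP C) (φ : Bilinear F G H), ∃! h : T ⟶ H,
      ∀ c d x y, h.hom.app _ (u.app c d x y) = φ.app c d x y := by
  let D : (F.obj.Elements × G.obj.Elements)ᵒᵖ ⥤ FP C :=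
    ((CategoryOfElements.π F.obj).prod (CategoryOfElements.π G.obj) ⋙ tensor C).op ⋙ yonedaFP C
  have : HasColimits (FP C) := hasColimits
  have w {i j : F.obj.Elements × G.obj.Elements} (f : i ⟶ j) (p : i.1.1 ⊗ i.2.1 ⟶ j.1.1 ⊗ j.2.1)
      (hp : f.1.1 ⊗ₘ f.2.1 = p) :
      yonedaEquiv (colimit.ι D (op j)) =
        (colimit D).obj.map p (yonedaEquiv (colimit.ι D (op i))) := by
    subst hp
    exact (congrArg yonedaEquiv (colimit.w D f.op).symm).trans (yonedaEquiv_map_comp _ _)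
  refine ⟨colimit D, ⟨fun c d x y ↦ yonedaEquiv (colimit.ι D (op (⟨c, x⟩, ⟨d, y⟩))), ?_, ?_⟩, ?_⟩
  · intro c c' d p x y
    exact w (i := (⟨c, x⟩, ⟨d, y⟩)) (j := (⟨c', F.obj.map p x⟩, ⟨d, y⟩))
      (⟨p, rfl⟩, 𝟙 _) _ (tensorHom_id _ _)
  · intro c d d' q x y
    exact w (i := (⟨c, x⟩, ⟨d, y⟩)) (j := (⟨c, x⟩, ⟨d', G.obj.map q y⟩))
      (𝟙 _, ⟨q, rfl⟩) _ (id_tensorHom _ _)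
  · intro H φ
    let s : Cocone D :=
      { pt := H
        ι :=
          { app i := yonedaEquiv.symm (φ.app _ _ i.unop.1.2 i.unop.2.2)
            naturality i j f := by
              refine (map_comp_yonedaEquiv_symm _ _).trans ?_
              refine Eq.trans (congrArg _ ?_) (Category.comp_id _).symm
              obtain ⟨⟨⟨p, hp⟩, ⟨q, hq⟩⟩⟩ := f
              refine Eq.trans ?_ (congrArg₂ (φ.app _ _) hp hq)
              exact (φ.map p q _ _).symm } }
    refine ⟨colimit.desc D s, ?_, ?_⟩
    · intro c d x y
      exact (congrArg yonedaEquiv (colimit.ι_desc s (op (⟨c, x⟩, ⟨d, y⟩)))).trans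
        (yonedaEquiv.apply_symm_apply _)
    · intro h hh
      refine colimit.hom_ext fun i ↦ ?_
      rw [colimit.ι_desc]
      apply yonedaEquiv.injective
      refine Eq.trans (hh _ _ i.unop.1.2 i.unop.2.2) ?_
      exact (yonedaEquiv.apply_symm_apply _).symm

/-- The tensor product of finite product preserving functors: the representing object for
bilinear families. -/
noncomputable def tens (F G : FP C) : FP C := (exists_tensor F G).choose

/-- The universal bilinear family. -/
noncomputable def tensBilinear (F G : FP C) : Bilinear F G (tens F G) :=
  (exists_tensor F G).choose_spec.choose

/-- Pure tensors. -/
noncomputable def tmul {F G : FP C} {c d : C} (x : F.obj.obj c) (y : G.obj.obj d) :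
    (tens F G).obj.obj (c ⊗ d) :=
  (tensBilinear F G).app c d x y

lemma tmul_map_left {F G : FP C} {c c' d : C} (p : c ⟶ c')
    (x : F.obj.obj c) (y : G.obj.obj d) :
    tmul (F.obj.map p x) y = (tens F G).obj.map (p ▷ d) (tmul x y) :=
  (tensBilinear F G).map_left _ p x y

lemma tmul_map_right {F G : FP C} {c d d' : C} (q : d ⟶ d')
    (x : F.obj.obj c) (y : G.obj.obj d) :
    tmul x (G.obj.map q y) = (tens F G).obj.map (c ◁ q) (tmul x y) :=
  (tensBilinear F G).map_right _ q x y

/-- The morphism which corresponds to a bilinear family. -/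
noncomputable def desc {F G H : FP C} (φ : Bilinear F G H) : tens F G ⟶ H :=
  ((exists_tensor F G).choose_spec.choose_spec H φ).choose

lemma desc_tmul {F G H : FP C} (φ : Bilinear F G H) {c d : C} (x : F.obj.obj c)
    (y : G.obj.obj d) : (desc φ).hom.app _ (tmul x y) = φ.app c d x y :=
  ((exists_tensor F G).choose_spec.choose_spec H φ).choose_spec.1 c d x y

/-- The bilinear family of a morphism. -/
noncomputable def bilinearOfHom {F G H : FP C} (h : tens F G ⟶ H) : Bilinear F G H where
  app c d x y := h.hom.app _ (tmul x y)
  map_left d p x y := by rw [tmul_map_left, map_app]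
  map_right c _ _ q x y := by rw [tmul_map_right, map_app]

lemma tens_ext {F G H : FP C} {u v : tens F G ⟶ H}
    (h : ∀ c d (x : F.obj.obj c) (y : G.obj.obj d),
      u.hom.app _ (tmul x y) = v.hom.app _ (tmul x y)) : u = v :=
  ((exists_tensor F G).choose_spec.choose_spec H (bilinearOfHom v)).unique h (fun _ _ _ _ ↦ rfl)

section Multilinear

variable [∀ c : C, PreservesFiniteProducts (tensorRight c)]

/-- Tensoring on the right with an element. -/
noncomputable def tmulRight {F G H : FP C} (u : tens F G ⟶ H) {d : C} (y : G.obj.obj d) :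
    F ⟶ shift (tensorRight d) H :=
  homMk (G := shift (tensorRight d) H) (fun _ x ↦ u.hom.app _ (tmul x y))
    (fun _ _ p x ↦ (bilinearOfHom u).map_left d p x y)

/-- With `z` fixed, both maps become maps from `tens F G` to `K (- ⊗ c)`. This functor lies in `FP
C` because `- ⊗ c` preserves products, so extensionality on pure tensors applies again. -/
lemma tens_ext₃ {F G H K : FP C} {u v : tens (tens F G) H ⟶ K}
    (h : ∀ a b c (x : F.obj.obj a) (y : G.obj.obj b) (z : H.obj.obj c),
      u.hom.app _ (tmul (tmul x y) z) = v.hom.app _ (tmul (tmul x y) z)) : u = v := by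
  refine tens_ext fun e c t z ↦ ?_
  have : tmulRight u z = tmulRight v z := tens_ext fun a b x y ↦ h a b c x y z
  exact congrArg (fun k ↦ k.hom.app e t) this

lemma tens_ext₄ {F G H M K : FP C} {u v : tens (tens (tens F G) H) M ⟶ K}
    (h : ∀ a b c d (x : F.obj.obj a) (y : G.obj.obj b) (z : H.obj.obj c) (w : M.obj.obj d),
      u.hom.app _ (tmul (tmul (tmul x y) z) w) = v.hom.app _ (tmul (tmul (tmul x y) z) w)) :
    u = v := by
  refine tens_ext fun e d t w ↦ ?_
  have : tmulRight u w = tmulRight v w := tens_ext₃ fun a b c x y z ↦ h a b c d x y z w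
  exact congrArg (fun k ↦ k.hom.app e t) this

/-- For each `z` the family is bilinear with values in `K (- ⊗ c)`; the resulting maps `ψ z` depend
naturally on `z` and so form a bilinear family on `tens F G` and `H`. -/
theorem exists_desc₃ {F G H K : FP C}
    (φ : ∀ a b c, F.obj.obj a → G.obj.obj b → H.obj.obj c → K.obj.obj ((a ⊗ b) ⊗ c))
    (h₁ : ∀ {a a'} b c (p : a ⟶ a') x y z,
      φ a' b c (F.obj.map p x) y z = K.obj.map ((p ▷ b) ▷ c) (φ a b c x y z))
    (h₂ : ∀ a {b b'} c (p : b ⟶ b') x y z,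
      φ a b' c x (G.obj.map p y) z = K.obj.map ((a ◁ p) ▷ c) (φ a b c x y z))
    (h₃ : ∀ a b {c c'} (p : c ⟶ c') x y z,
      φ a b c' x y (H.obj.map p z) = K.obj.map ((a ⊗ b) ◁ p) (φ a b c x y z)) :
    ∃ u : tens (tens F G) H ⟶ K, ∀ a b c x y z,
      u.hom.app _ (tmul (tmul x y) z) = φ a b c x y z := by
  let ψ {c : C} (z : H.obj.obj c) : tens F G ⟶ shift (tensorRight c) K :=
    desc ⟨fun a b x y ↦ φ a b c x y z, fun b p x y ↦ h₁ b c p x y z,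
      fun a _ _ p x y ↦ h₂ a c p x y z⟩
  have hd {a b c : C} (z : H.obj.obj c) (x : F.obj.obj a) (y : G.obj.obj b) :
      (ψ z).hom.app _ (tmul x y) = φ a b c x y z := desc_tmul _ x y
  let σ {c c' : C} (p : c ⟶ c') : shift (tensorRight c) K ⟶ shift (tensorRight c') K :=
    ⟨Functor.whiskerRight ((tensoringRight C).map p) K.obj⟩
  have hψ {c c' : C} (p : c ⟶ c') (z : H.obj.obj c) : ψ (H.obj.map p z) = ψ z ≫ σ p := by
    refine tens_ext fun a b x y ↦ ?_
    refine (desc_tmul _ x y).trans ?_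
    refine (h₃ a b p x y z).trans ?_
    exact congrArg (K.obj.map ((a ⊗ b) ◁ p)) (hd z x y).symm
  refine ⟨desc ⟨fun e c t z ↦ (ψ z).hom.app e t, fun c p t z ↦ map_app (ψ z) p t,
    fun e c c' p t z ↦ ?_⟩, fun a b c x y z ↦ ?_⟩
  · exact congrArg (fun k ↦ k.hom.app e t) (hψ p z)
  · exact (desc_tmul _ _ z).trans (desc_tmul _ x y)

end Multilinear

section MultilinearLeft

variable [∀ c : C, PreservesFiniteProducts (tensorLeft c)]

/-- Tensoring on the left with an element. -/
noncomputable def tmulLeft {F G H : FP C} (u : tens F G ⟶ H) {c : C} (x : F.obj.obj c) :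
    G ⟶ shift (tensorLeft c) H :=
  homMk (G := shift (tensorLeft c) H) (fun _ y ↦ u.hom.app _ (tmul x y))
    (fun _ _ q y ↦ (bilinearOfHom u).map_right c q x y)

lemma tens_ext₃' {F G H K : FP C} {u v : tens F (tens G H) ⟶ K}
    (h : ∀ a b c (x : F.obj.obj a) (y : G.obj.obj b) (z : H.obj.obj c),
      u.hom.app _ (tmul x (tmul y z)) = v.hom.app _ (tmul x (tmul y z))) : u = v := by
  refine tens_ext fun a e x t ↦ ?_
  have : tmulLeft u x = tmulLeft v x := tens_ext fun b c y z ↦ h a b c x y z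
  exact congrArg (fun k ↦ k.hom.app e t) this

theorem exists_desc₃' {F G H K : FP C}
    (φ : ∀ a b c, F.obj.obj a → G.obj.obj b → H.obj.obj c → K.obj.obj (a ⊗ b ⊗ c))
    (h₁ : ∀ {a a'} b c (p : a ⟶ a') x y z,
      φ a' b c (F.obj.map p x) y z = K.obj.map (p ▷ (b ⊗ c)) (φ a b c x y z))
    (h₂ : ∀ a {b b'} c (p : b ⟶ b') x y z,
      φ a b' c x (G.obj.map p y) z = K.obj.map (a ◁ p ▷ c) (φ a b c x y z))
    (h₃ : ∀ a b {c c'} (p : c ⟶ c') x y z,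
      φ a b c' x y (H.obj.map p z) = K.obj.map (a ◁ b ◁ p) (φ a b c x y z)) :
    ∃ u : tens F (tens G H) ⟶ K, ∀ a b c x y z,
      u.hom.app _ (tmul x (tmul y z)) = φ a b c x y z := by
  let ψ {a : C} (x : F.obj.obj a) : tens G H ⟶ shift (tensorLeft a) K :=
    desc ⟨fun b c y z ↦ φ a b c x y z, fun c p y z ↦ h₂ a c p x y z,
      fun b _ _ p y z ↦ h₃ a b p x y z⟩
  have hd {a b c : C} (x : F.obj.obj a) (y : G.obj.obj b) (z : H.obj.obj c) :
      (ψ x).hom.app _ (tmul y z) = φ a b c x y z := desc_tmul _ y z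
  let σ {a a' : C} (p : a ⟶ a') : shift (tensorLeft a) K ⟶ shift (tensorLeft a') K :=
    ⟨Functor.whiskerRight ((tensoringLeft C).map p) K.obj⟩
  have hψ {a a' : C} (p : a ⟶ a') (x : F.obj.obj a) : ψ (F.obj.map p x) = ψ x ≫ σ p := by
    refine tens_ext fun b c y z ↦ ?_
    refine (desc_tmul _ y z).trans ?_
    refine (h₁ b c p x y z).trans ?_
    exact congrArg (K.obj.map (p ▷ (b ⊗ c))) (hd x y z).symm
  refine ⟨desc ⟨fun a e x t ↦ (ψ x).hom.app e t, fun e p x t ↦ ?_,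
    fun a e e' p x t ↦ map_app (ψ x) p t⟩, fun a b c x y z ↦ ?_⟩
  · exact congrArg (fun k ↦ k.hom.app e t) (hψ p x)
  · exact (desc_tmul _ x _).trans (desc_tmul _ y z)

end MultilinearLeft

/-- The tensor product of morphisms. -/
noncomputable def tensMap {F G F' G' : FP C} (f : F ⟶ F') (g : G ⟶ G') : tens F G ⟶ tens F' G' :=
  desc
    { app c d x y := tmul (f.hom.app c x) (g.hom.app d y)
      map_left d p x y := by rw [map_app, tmul_map_left]
      map_right c _ _ q x y := by rw [map_app, tmul_map_right] }

lemma tensMap_tmul {F G F' G' : FP C} (f : F ⟶ F') (g : G ⟶ G') {c d : C} (x : F.obj.obj c)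
    (y : G.obj.obj d) :
    (tensMap f g).hom.app _ (tmul x y) = tmul (f.hom.app c x) (g.hom.app d y) :=
  desc_tmul _ x y

section Associator

variable [∀ c : C, PreservesFiniteProducts (tensorLeft c)]
  [∀ c : C, PreservesFiniteProducts (tensorRight c)]

/-- Both sides represent trilinear families. The inverse associator of `C` appears because the value
must live at `(a ⊗ b) ⊗ c`, whereas `x ⊗ (y ⊗ z)` lives at `a ⊗ (b ⊗ c)`. -/
theorem exists_assoc (F G H : FP C) : ∃ i : tens (tens F G) H ≅ tens F (tens G H),
    ∀ a b c (x : F.obj.obj a) (y : G.obj.obj b) (z : H.obj.obj c),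
      i.hom.hom.app _ (tmul (tmul x y) z) =
        (tens F (tens G H)).obj.map (α_ a b c).inv (tmul x (tmul y z)) := by
  obtain ⟨u, hu⟩ := exists_desc₃ (F := F) (G := G) (H := H) (K := tens F (tens G H))
    (fun a b c x y z ↦ (tens F (tens G H)).obj.map (α_ a b c).inv (tmul x (tmul y z)))
    (by intros; simp only [tmul_map_left, obj_map_comp]; simp)
    (by intros; simp only [tmul_map_left, tmul_map_right, obj_map_comp]; simp)
    (by intros; simp only [tmul_map_right, obj_map_comp]; simp)
  obtain ⟨v, hv⟩ := exists_desc₃' (F := F) (G := G) (H := H) (K := tens (tens F G) H)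
    (fun a b c x y z ↦ (tens (tens F G) H).obj.map (α_ a b c).hom (tmul (tmul x y) z))
    (by intros; simp only [tmul_map_left, obj_map_comp]; simp)
    (by intros; simp only [tmul_map_left, tmul_map_right, obj_map_comp]; simp)
    (by intros; simp only [tmul_map_right, obj_map_comp]; simp)
  refine ⟨⟨u, v, tens_ext₃ fun a b c x y z ↦ ?_, tens_ext₃' fun a b c x y z ↦ ?_⟩, hu⟩
  · rw [comp_app, hu, map_app, hv, obj_map_comp, Iso.hom_inv_id]
    exact Functor.map_id_apply _ _ _
  · rw [comp_app, hv, map_app, hu, obj_map_comp, Iso.inv_hom_id]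
    exact Functor.map_id_apply _ _ _

end Associator

end FPFunctor

/-! ### Day convolution: unit, coherence and symmetry -/

namespace FPFunctor

open Opposite

lemma id_app {C : Type u} [SmallCategory C] (F : FP C) (c : C) (x : F.obj.obj c) : (𝟙 F : F ⟶ F).hom.app c x = x := rfl

variable {C : Type u} [SmallCategory C] [MonoidalCategory C]

/-- The unit of the tensor product of finite product preserving functors. -/
def tensUnit (C : Type u) [SmallCategory C] [MonoidalCategory C] : FP C :=
  (yonedaFP C).obj (op (𝟙_ C))

/-- The universal element of the unit. -/
def one : (tensUnit C).obj.obj (𝟙_ C) := 𝟙 (𝟙_ C)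

lemma map_one {c : C} (p : (tensUnit C).obj.obj c) :
    (tensUnit C).obj.map (show 𝟙_ C ⟶ c from p) one = p :=
  Category.id_comp (show 𝟙_ C ⟶ c from p)

variable [HasFiniteProducts C]

/-- Every element of the unit is the image of `one` under a map of `C`, so bilinearity leaves only
the tensors `one ⊗ y`. -/
lemma unit_tens_ext {F H : FP C} {u v : tens (tensUnit C) F ⟶ H}
    (h : ∀ d (y : F.obj.obj d), u.hom.app _ (tmul one y) = v.hom.app _ (tmul one y)) : u = v := by
  refine tens_ext fun c d p y ↦ ?_
  rw [← map_one p, tmul_map_left, map_app, map_app, h]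

lemma tens_unit_ext {F H : FP C} {u v : tens F (tensUnit C) ⟶ H}
    (h : ∀ d (y : F.obj.obj d), u.hom.app _ (tmul y one) = v.hom.app _ (tmul y one)) : u = v := by
  refine tens_ext fun c d y p ↦ ?_
  rw [← map_one p, tmul_map_right, map_app, map_app, h]

theorem exists_leftUnitor (F : FP C) : ∃ i : tens (tensUnit C) F ≅ F,
    ∀ c (x : F.obj.obj c), i.hom.hom.app _ (tmul one x) = F.obj.map (λ_ c).inv x := by
  let u : tens (tensUnit C) F ⟶ F := desc
    { app c d p x := F.obj.map ((λ_ d).inv ≫ (show 𝟙_ C ⟶ c from p) ▷ d) x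
      map_left d p q x := by
        rw [obj_map_comp, Category.assoc, ← comp_whiskerRight]
        rfl
      map_right c _ _ q p x := by
        rw [obj_map_comp, obj_map_comp, Category.assoc, ← whisker_exchange,
          leftUnitor_inv_naturality_assoc] }
  have hu : ∀ c (x : F.obj.obj c), u.hom.app _ (tmul one x) = F.obj.map (λ_ c).inv x :=
    fun c x ↦ (desc_tmul _ one x).trans (by
      dsimp only [one]
      rw [id_whiskerRight, Category.comp_id])
  let v : F ⟶ tens (tensUnit C) F :=
    homMk (fun c x ↦ (tens (tensUnit C) F).obj.map (λ_ c).hom (tmul one x)) fun c d p x ↦ by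
      rw [tmul_map_right, obj_map_comp, obj_map_comp, leftUnitor_naturality]
  refine ⟨⟨u, v, unit_tens_ext fun c x ↦ ?_, hom_ext fun c x ↦ ?_⟩, hu⟩
  · rw [comp_app, hu, homMk_app, tmul_map_right, obj_map_comp, leftUnitor_naturality,
      Iso.hom_inv_id]
    exact Functor.map_id_apply _ _ _
  · rw [comp_app, homMk_app, map_app, hu, obj_map_comp, Iso.inv_hom_id]
    exact Functor.map_id_apply _ _ _

theorem exists_rightUnitor (F : FP C) : ∃ i : tens F (tensUnit C) ≅ F,
    ∀ c (x : F.obj.obj c), i.hom.hom.app _ (tmul x one) = F.obj.map (ρ_ c).inv x := by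
  let u : tens F (tensUnit C) ⟶ F := desc
    { app d c x p := F.obj.map ((ρ_ d).inv ≫ d ◁ (show 𝟙_ C ⟶ c from p)) x
      map_right d _ _ q x p := by
        rw [obj_map_comp, Category.assoc, ← whiskerLeft_comp]
        rfl
      map_left d q x p := by
        rw [obj_map_comp, obj_map_comp, Category.assoc, whisker_exchange,
          rightUnitor_inv_naturality_assoc] }
  have hu : ∀ c (x : F.obj.obj c), u.hom.app _ (tmul x one) = F.obj.map (ρ_ c).inv x :=
    fun c x ↦ (desc_tmul _ x one).trans (by
      dsimp only [one]
      rw [whiskerLeft_id, Category.comp_id])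
  let v : F ⟶ tens F (tensUnit C) :=
    homMk (fun c x ↦ (tens F (tensUnit C)).obj.map (ρ_ c).hom (tmul x one)) fun c d p x ↦ by
      rw [tmul_map_left, obj_map_comp, obj_map_comp, rightUnitor_naturality]
  refine ⟨⟨u, v, tens_unit_ext fun c x ↦ ?_, hom_ext fun c x ↦ ?_⟩, hu⟩
  · rw [comp_app, hu, homMk_app, tmul_map_left, obj_map_comp, rightUnitor_naturality,
      Iso.hom_inv_id]
    exact Functor.map_id_apply _ _ _
  · rw [comp_app, homMk_app, map_app, hu, obj_map_comp, Iso.inv_hom_id]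
    exact Functor.map_id_apply _ _ _

theorem exists_braiding [BraidedCategory C] (F G : FP C) : ∃ u : tens F G ⟶ tens G F,
    ∀ c d (x : F.obj.obj c) (y : G.obj.obj d), u.hom.app _ (tmul x y) =
      (tens G F).obj.map (β_ d c).hom (tmul y x) := by
  refine ⟨desc
    { app c d x y := (tens G F).obj.map (β_ d c).hom (tmul y x)
      map_left d p x y := ?_
      map_right c _ _ q x y := ?_ }, fun c d x y ↦ desc_tmul _ x y⟩
  · rw [tmul_map_right, obj_map_comp, obj_map_comp, BraidedCategory.braiding_naturality_right]
  · rw [tmul_map_left, obj_map_comp, obj_map_comp, BraidedCategory.braiding_naturality_left]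

section Monoidal

variable [∀ c : C, PreservesFiniteProducts (tensorLeft c)]
  [∀ c : C, PreservesFiniteProducts (tensorRight c)]

noncomputable instance : MonoidalCategoryStruct (FP C) where
  tensorObj := tens
  whiskerLeft F _ _ g := tensMap (𝟙 F) g
  whiskerRight f G := tensMap f (𝟙 G)
  tensorHom := tensMap
  tensorUnit := tensUnit C
  associator F G H := (exists_assoc F G H).choose
  leftUnitor F := (exists_leftUnitor F).choose
  rightUnitor F := (exists_rightUnitor F).choose

/-- Pure tensors, for the monoidal structure. -/
noncomputable def pure {F G : FP C} {c d : C} (x : F.obj.obj c) (y : G.obj.obj d) :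
    (F ⊗ G : FP C).obj.obj (c ⊗ d) := tmul x y

lemma tensorHom_pure {F G F' G' : FP C} (f : F ⟶ F') (g : G ⟶ G') {c d : C} (x : F.obj.obj c)
    (y : G.obj.obj d) : (f ⊗ₘ g).hom.app _ (pure x y) = pure (f.hom.app c x) (g.hom.app d y) :=
  tensMap_tmul f g x y

lemma whiskerRight_pure {F G F' : FP C} (f : F ⟶ F') {c d : C} (x : F.obj.obj c)
    (y : G.obj.obj d) : (f ▷ G).hom.app _ (pure x y) = pure (f.hom.app c x) y :=
  tensMap_tmul f (𝟙 G) x y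

lemma whiskerLeft_pure {F G G' : FP C} (g : G ⟶ G') {c d : C} (x : F.obj.obj c)
    (y : G.obj.obj d) : (F ◁ g).hom.app _ (pure x y) = pure x (g.hom.app d y) :=
  tensMap_tmul (𝟙 F) g x y

lemma pure_map_left {F G : FP C} {c c' d : C} (p : c ⟶ c') (x : F.obj.obj c) (y : G.obj.obj d) :
    pure (F.obj.map p x) y = (F ⊗ G : FP C).obj.map (p ▷ d) (pure x y) :=
  tmul_map_left p x y

lemma pure_map_right {F G : FP C} {c d d' : C} (q : d ⟶ d') (x : F.obj.obj c) (y : G.obj.obj d) :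
    pure x (G.obj.map q y) = (F ⊗ G : FP C).obj.map (c ◁ q) (pure x y) :=
  tmul_map_right q x y

lemma associator_pure {F G H : FP C} {a b c : C} (x : F.obj.obj a) (y : G.obj.obj b)
    (z : H.obj.obj c) : (α_ F G H).hom.hom.app _ (pure (pure x y) z) =
      (F ⊗ G ⊗ H : FP C).obj.map (α_ a b c).inv (pure x (pure y z)) :=
  (exists_assoc F G H).choose_spec a b c x y z

/-- The universal element of the unit. -/
def unitOne : (𝟙_ (FP C)).obj.obj (𝟙_ C) := one

lemma exists_map_unitOne {c : C} (p : (𝟙_ (FP C)).obj.obj c) :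
    ∃ q : 𝟙_ C ⟶ c, (𝟙_ (FP C)).obj.map q unitOne = p :=
  ⟨p, map_one p⟩

lemma leftUnitor_pure {F : FP C} {c : C} (x : F.obj.obj c) :
    (λ_ F).hom.hom.app _ (pure unitOne x) = F.obj.map (λ_ c).inv x :=
  (exists_leftUnitor F).choose_spec c x

lemma rightUnitor_pure {F : FP C} {c : C} (x : F.obj.obj c) :
    (ρ_ F).hom.hom.app _ (pure x unitOne) = F.obj.map (ρ_ c).inv x :=
  (exists_rightUnitor F).choose_spec c x

lemma tensor_ext {F G H : FP C} {u v : F ⊗ G ⟶ H}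
    (h : ∀ c d (x : F.obj.obj c) (y : G.obj.obj d),
      u.hom.app _ (pure x y) = v.hom.app _ (pure x y)) : u = v :=
  tens_ext h

lemma tensor_ext₃ {F G H K : FP C} {u v : (F ⊗ G) ⊗ H ⟶ K}
    (h : ∀ a b c (x : F.obj.obj a) (y : G.obj.obj b) (z : H.obj.obj c),
      u.hom.app _ (pure (pure x y) z) = v.hom.app _ (pure (pure x y) z)) : u = v :=
  tens_ext₃ h

lemma tensor_ext₃' {F G H K : FP C} {u v : F ⊗ (G ⊗ H) ⟶ K}
    (h : ∀ a b c (x : F.obj.obj a) (y : G.obj.obj b) (z : H.obj.obj c),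
      u.hom.app _ (pure x (pure y z)) = v.hom.app _ (pure x (pure y z))) : u = v :=
  tens_ext₃' h

lemma tensor_ext₄ {F G H M K : FP C} {u v : ((F ⊗ G) ⊗ H) ⊗ M ⟶ K}
    (h : ∀ a b c d (x : F.obj.obj a) (y : G.obj.obj b) (z : H.obj.obj c) (w : M.obj.obj d),
      u.hom.app _ (pure (pure (pure x y) z) w) = v.hom.app _ (pure (pure (pure x y) z) w)) :
    u = v :=
  tens_ext₄ h

lemma unit_tensor_ext {F H : FP C} {u v : 𝟙_ (FP C) ⊗ F ⟶ H}
    (h : ∀ d (y : F.obj.obj d), u.hom.app _ (pure unitOne y) = v.hom.app _ (pure unitOne y)) :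
    u = v :=
  unit_tens_ext h

lemma tensor_unit_ext {F H : FP C} {u v : F ⊗ 𝟙_ (FP C) ⟶ H}
    (h : ∀ d (y : F.obj.obj d), u.hom.app _ (pure y unitOne) = v.hom.app _ (pure y unitOne)) :
    u = v :=
  tens_unit_ext h

-- Each axiom is tested on pure tensors, where it becomes the corresponding coherence or naturality
-- law of `C` applied to an element.
noncomputable instance : MonoidalCategory (FP C) :=
  MonoidalCategory.ofTensorHom
    (id_tensorHom_id := fun F G ↦ tensor_ext fun c d x y ↦ by
      rw [tensorHom_pure, id_app, id_app, id_app])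
    (id_tensorHom := fun _ _ _ _ ↦ rfl)
    (tensorHom_id := fun _ _ ↦ rfl)
    (tensorHom_comp_tensorHom := fun f₁ f₂ g₁ g₂ ↦ tensor_ext fun c d x y ↦ by
      simp only [tensorHom_pure, comp_app])
    (associator_naturality := fun f g h ↦ tensor_ext₃ fun a b c x y z ↦ by
      simp only [tensorHom_pure, comp_app, associator_pure, map_app])
    (leftUnitor_naturality := fun {F G} f ↦ unit_tensor_ext fun d y ↦ by
      simp only [tensorHom_pure, comp_app, leftUnitor_pure, map_app, id_app])
    (rightUnitor_naturality := fun {F G} f ↦ tensor_unit_ext fun d y ↦ by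
      simp only [tensorHom_pure, comp_app, rightUnitor_pure, map_app, id_app])
    (pentagon := fun F G H K ↦ tensor_ext₄ fun a b c d x y z w ↦ by
      simp only [tensorHom_pure, comp_app, associator_pure, map_app, id_app, pure_map_left,
        pure_map_right, obj_map_comp, Category.assoc, pentagon_inv])
    (triangle := fun F G ↦ tensor_ext₃ fun a b c x p z ↦ by
      -- The unitors are known only on `unitOne`, so a general element of the unit is first written
      -- as its image.
      obtain ⟨q, rfl⟩ := exists_map_unitOne p
      simp only [tensorHom_pure, comp_app, associator_pure, map_app, id_app, pure_map_left,
        pure_map_right, obj_map_comp, leftUnitor_pure, rightUnitor_pure]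
      simp)

lemma associator_inv_pure {F G H : FP C} {a b c : C} (x : F.obj.obj a) (y : G.obj.obj b)
    (z : H.obj.obj c) : (α_ F G H).inv.hom.app _ (pure x (pure y z)) =
      ((F ⊗ G) ⊗ H : FP C).obj.map (α_ a b c).hom (pure (pure x y) z) := by
  have h : (α_ F G H).hom.hom.app _ (((F ⊗ G) ⊗ H : FP C).obj.map (α_ a b c).hom
      (pure (pure x y) z)) = pure x (pure y z) := by
    rw [map_app, associator_pure, obj_map_comp, Iso.inv_hom_id]
    exact Functor.map_id_apply _ _ _
  rw [← h, ← comp_app, Iso.hom_inv_id, id_app]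

noncomputable instance [SymmetricCategory C] : SymmetricCategory (FP C) :=
  let s (F G : FP C) : F ⊗ G ⟶ G ⊗ F := (exists_braiding F G).choose
  have hs (F G : FP C) (c d : C) (x : F.obj.obj c) (y : G.obj.obj d) :
    (s F G).hom.app _ (pure x y) = (G ⊗ F : FP C).obj.map (β_ d c).hom (pure y x) :=
    (exists_braiding F G).choose_spec c d x y
  have hs' (F G : FP C) : s F G ≫ s G F = 𝟙 _ := tensor_ext fun c d x y ↦ by
    rw [comp_app, hs, map_app, hs, obj_map_comp, SymmetricCategory.symmetry]
    exact Functor.map_id_apply _ _ _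
  { braiding F G := ⟨s F G, s G F, hs' F G, hs' G F⟩
    symmetry F G := hs' F G
    braiding_naturality_right F _ _ g := tensor_ext fun c d x y ↦ by
      simp only [whiskerLeft_pure, whiskerRight_pure, comp_app, hs, map_app]
    braiding_naturality_left f G := tensor_ext fun c d x y ↦ by
      simp only [whiskerLeft_pure, whiskerRight_pure, comp_app, hs, map_app]
    hexagon_forward F G H := tensor_ext₃ fun a b c x y z ↦ by
      simp only [whiskerLeft_pure, whiskerRight_pure, comp_app, hs, map_app, associator_pure,
        pure_map_left, pure_map_right, obj_map_comp, Category.assoc, BraidedCategory.hexagon_reverse]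
    hexagon_reverse F G H := tensor_ext₃' fun a b c x y z ↦ by
      simp only [whiskerLeft_pure, whiskerRight_pure, comp_app, hs, map_app, associator_inv_pure,
        pure_map_left, pure_map_right, obj_map_comp, Category.assoc, BraidedCategory.hexagon_forward] }

end Monoidal

end FPFunctor

/-! ### Day convolution: internal hom -/

namespace FPFunctor

open Opposite

variable {C : Type u} [SmallCategory C] [MonoidalCategory C]
  [∀ c : C, PreservesFiniteProducts (tensorRight c)]

section InternalHom

/-- The functoriality of `shift (tensorRight c) H` in `c`. -/
def shiftMap (H : FP C) {c c' : C} (p : c ⟶ c') :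
    shift (tensorRight c) H ⟶ shift (tensorRight c') H :=
  ⟨Functor.whiskerRight ((tensoringRight C).map p) H.obj⟩

lemma shiftMap_app (H : FP C) {c c' : C} (p : c ⟶ c') (a : C)
    (x : (shift (tensorRight c) H).obj.obj a) :
    (shiftMap H p).hom.app a x = H.obj.map (a ◁ p) x := rfl

/-- The internal hom of finite product preserving functors, as a functor. -/
def internalHom (F H : FP C) : C ⥤ Type u where
  obj c := F ⟶ shift (tensorRight c) H
  map p := ↾fun f ↦ f ≫ shiftMap H p
  map_id c := by
    refine ConcreteCategory.hom_ext _ _ fun f ↦ ?_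
    refine hom_ext fun a x ↦ ?_
    refine (shiftMap_app H (𝟙 c) a _).trans ?_
    rw [whiskerLeft_id]
    exact Functor.map_id_apply _ _ _
  map_comp p q := by
    refine ConcreteCategory.hom_ext _ _ fun f ↦ ?_
    refine hom_ext fun a x ↦ ?_
    refine (shiftMap_app H (p ≫ q) a _).trans ?_
    rw [whiskerLeft_comp]
    exact Functor.map_comp_apply _ _ _ _

variable [HasFiniteProducts C] [∀ c : C, PreservesFiniteProducts (tensorLeft c)]

/-- The internal hom of finite product preserving functors. -/
def ihomObj (F H : FP C) : FP C :=
  ⟨internalHom F H, by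
    have ex {c d b b' : C} (p : c ⟶ d) (q : b ⟶ b') (z : H.obj.obj (c ⊗ b)) :
        H.obj.map (p ▷ b') (H.obj.map (c ◁ q) z) = H.obj.map (d ◁ q) (H.obj.map (p ▷ b) z) := by
      rw [obj_map_comp, obj_map_comp, whisker_exchange]
    -- Product preservation of the internal hom is pointwise that of `H (c ⊗ -)`, which is why
    -- `tensorLeft` must preserve products. The condition on `tensorRight` only puts the targets `H
    -- (- ⊗ c)` in `FP C`.
    have ht (c : C) : Nonempty (Unique (H.obj.obj (c ⊗ ⊤_ C))) :=
      ((preservesFiniteProducts_iff _).1 (shift (tensorLeft c) H).property).1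
    have hb (c a b : C) := ((preservesFiniteProducts_iff _).1
      (shift (tensorLeft c) H).property).2 a b
    refine (preservesFiniteProducts_iff _).2 ⟨⟨⟨⟨homMk (G := shift (tensorRight (⊤_ C)) H)
      (fun c _ ↦ (ht c).some.default) fun c d p x ↦ ?_⟩, fun f ↦ hom_ext fun c x ↦ ?_⟩⟩,
      fun a b ↦ ⟨fun f g h ↦ hom_ext fun c x ↦ (hb c a b).1 (Prod.ext ?_ ?_), fun ⟨f, g⟩ ↦ ?_⟩⟩
    · exact ((ht d).some.uniq _).symm
    · exact (ht c).some.uniq _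
    · exact congrArg (fun k : F ⟶ shift (tensorRight a) H ↦ k.hom.app c x) (congrArg Prod.fst h)
    · exact congrArg (fun k : F ⟶ shift (tensorRight b) H ↦ k.hom.app c x) (congrArg Prod.snd h)
    · choose k hk using fun c x ↦ (hb c a b).2 (f.hom.app c x, g.hom.app c x)
      have hk₁ (c x) : H.obj.map (c ◁ prod.fst) (k c x) = f.hom.app c x :=
        congrArg Prod.fst (hk c x)
      have hk₂ (c x) : H.obj.map (c ◁ prod.snd) (k c x) = g.hom.app c x :=
        congrArg Prod.snd (hk c x)
      refine ⟨homMk (G := shift (tensorRight (a ⨯ b)) H) k fun c d p x ↦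
        (hb d a b).1 (Prod.ext ?_ ?_), Prod.ext (hom_ext hk₁) (hom_ext hk₂)⟩
      · refine (hk₁ _ _).trans ((map_app f p x).trans ?_)
        refine (congrArg (H.obj.map (p ▷ a)) (hk₁ c x).symm).trans ?_
        exact ex p prod.fst (k c x)
      · refine (hk₂ _ _).trans ((map_app g p x).trans ?_)
        refine (congrArg (H.obj.map (p ▷ b)) (hk₂ c x).symm).trans ?_
        exact ex p prod.snd (k c x)⟩

/-- The tensor product is left adjoint to the internal hom. -/
noncomputable def tensorHomEquiv (F G H : FP C) : (F ⊗ G ⟶ H) ≃ (G ⟶ ihomObj F H) where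
  toFun u := homMk (G := ihomObj F H) (fun _ y ↦ tmulRight u y) fun _ _ p y ↦
    hom_ext fun a x ↦ (bilinearOfHom u).map_right a p x y
  invFun v := desc
    { app c d x y := (show F ⟶ shift (tensorRight d) H from v.hom.app d y).hom.app c x
      map_left d p x y := map_app (show F ⟶ shift (tensorRight d) H from v.hom.app d y) p x
      map_right c _ _ q x y := congrArg (fun k : F ⟶ shift (tensorRight _) H ↦ k.hom.app c x)
        (map_app v q y) }
  left_inv _ := tensor_ext fun _ _ x y ↦ desc_tmul _ x y
  right_inv _ := hom_ext fun d y ↦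
    hom_ext (F := F) (G := shift (tensorRight d) H) fun _ x ↦ desc_tmul _ x y

theorem nonempty_monoidalClosed : Nonempty (MonoidalClosed (FP C)) :=
  ⟨⟨fun F ↦ ⟨_, Adjunction.adjunctionOfEquivRight (F := tensorLeft F) (tensorHomEquiv F)
    fun _ _ H f g ↦ hom_ext fun d y ↦ hom_ext (F := F) (G := shift (tensorRight d) H)
      fun _ x ↦ congrArg (g.hom.app _) (whiskerLeft_pure f x y)⟩⟩⟩

end InternalHom

end FPFunctor

/-! ### Yoneda is strong monoidal for Day convolution -/

namespace FPFunctor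

open Opposite

section DayConvolution

variable {C : Type u} [SmallCategory C]

/-- The universal element of a representable functor. -/
def univ (c : C) : ((yonedaFP C).obj (op c)).obj.obj c := 𝟙 c

lemma exists_map_univ {c d : C} (x : ((yonedaFP C).obj (op c)).obj.obj d) :
    ∃ p : c ⟶ d, ((yonedaFP C).obj (op c)).obj.map p (univ c) = x :=
  ⟨x, Category.id_comp (show c ⟶ d from x)⟩

lemma map_app_univ {c d : C} (f : c ⟶ d) :
    ((yonedaFP C).map f.op).hom.app _ (univ d) = ((yonedaFP C).obj (op c)).obj.map f (univ c) :=
  (Category.comp_id f).trans (Category.id_comp f).symm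

lemma yoneda_ext {c : C} {H : FP C} {f g : (yonedaFP C).obj (op c) ⟶ H}
    (h : f.hom.app _ (univ c) = g.hom.app _ (univ c)) : f = g :=
  yonedaEquiv.injective h

variable [MonoidalCategory C] [HasFiniteProducts C]
  [∀ c : C, PreservesFiniteProducts (tensorLeft c)]
  [∀ c : C, PreservesFiniteProducts (tensorRight c)]

/-- Universal elements generate representables, so the single tensor of universal elements detects
maps. The monoidal laws for Yoneda are all checked on such tensors. -/
lemma yoneda_tensor_ext {c d : C} {H : FP C}
    {f g : (yonedaFP C).obj (op c) ⊗ (yonedaFP C).obj (op d) ⟶ H}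
    (h : f.hom.app _ (pure (univ c) (univ d)) = g.hom.app _ (pure (univ c) (univ d))) : f = g := by
  refine tensor_ext fun a b x y ↦ ?_
  obtain ⟨p, rfl⟩ := exists_map_univ x
  obtain ⟨q, rfl⟩ := exists_map_univ y
  rw [pure_map_left, pure_map_right, map_app, map_app, map_app, map_app, h]

lemma yoneda_tensor_ext₃ {c d e : C} {H : FP C}
    {f g : ((yonedaFP C).obj (op c) ⊗ (yonedaFP C).obj (op d)) ⊗ (yonedaFP C).obj (op e) ⟶ H}
    (h : f.hom.app _ (pure (pure (univ c) (univ d)) (univ e)) =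
      g.hom.app _ (pure (pure (univ c) (univ d)) (univ e))) : f = g := by
  refine tensor_ext₃ fun a b c x y z ↦ ?_
  obtain ⟨p, rfl⟩ := exists_map_univ x
  obtain ⟨q, rfl⟩ := exists_map_univ y
  obtain ⟨r, rfl⟩ := exists_map_univ z
  simp only [pure_map_left, pure_map_right, map_app, h]

/-- The two maps exchange the tensor of the universal elements with the universal element of `c ⊗
d`, so their composites fix generators. -/
theorem exists_yonedaTensorIso (c d : C) :
    ∃ i : (yonedaFP C).obj (op c) ⊗ (yonedaFP C).obj (op d) ≅ (yonedaFP C).obj (op (c ⊗ d)),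
      i.hom.hom.app _ (pure (univ c) (univ d)) = univ (c ⊗ d) := by
  let u : (yonedaFP C).obj (op c) ⊗ (yonedaFP C).obj (op d) ⟶ (yonedaFP C).obj (op (c ⊗ d)) := desc
    { app a b p q := (show c ⟶ a from p) ⊗ₘ (show d ⟶ b from q)
      map_left b p x y := (tensorHom_comp_whiskerRight (show c ⟶ _ from x) p (show d ⟶ b from y)).symm
      map_right a _ _ q x y := (tensorHom_comp_whiskerLeft x y q).symm }
  have hu : u.hom.app _ (pure (univ c) (univ d)) = univ (c ⊗ d) :=
    (desc_tmul _ _ _).trans (id_tensorHom_id _ _)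
  let v : (yonedaFP C).obj (op (c ⊗ d)) ⟶ (yonedaFP C).obj (op c) ⊗ (yonedaFP C).obj (op d) :=
    yonedaEquiv.symm (pure (univ c) (univ d))
  have hv : v.hom.app _ (univ (c ⊗ d)) = pure (univ c) (univ d) := yonedaEquiv.apply_symm_apply _
  exact ⟨⟨u, v, yoneda_tensor_ext (by rw [comp_app, hu, hv, id_app]),
    yoneda_ext (by rw [comp_app, hv, hu, id_app])⟩, hu⟩

/-- The tensor product of representable functors is representable. -/
noncomputable def yonedaTensorIso (c d : C) :
    (yonedaFP C).obj (op c) ⊗ (yonedaFP C).obj (op d) ≅ (yonedaFP C).obj (op (c ⊗ d)) :=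
  (exists_yonedaTensorIso c d).choose

lemma yonedaTensorIso_pure (c d : C) :
    (yonedaTensorIso c d).hom.hom.app _ (pure (univ c) (univ d)) = univ (c ⊗ d) :=
  (exists_yonedaTensorIso c d).choose_spec

lemma yonedaTensorIso_naturality_left {c c' : C} (f : c' ⟶ c) (d : C) :
    (yonedaFP C).map f.op ▷ _ ≫ (yonedaTensorIso c' d).hom =
      (yonedaTensorIso c d).hom ≫ (yonedaFP C).map (f ▷ d).op :=
  yoneda_tensor_ext (by
    simp only [comp_app, whiskerRight_pure, yonedaTensorIso_pure, map_app_univ, pure_map_left,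
      map_app])

lemma yonedaTensorIso_naturality_right (c : C) {d d' : C} (f : d' ⟶ d) :
    _ ◁ (yonedaFP C).map f.op ≫ (yonedaTensorIso c d').hom =
      (yonedaTensorIso c d).hom ≫ (yonedaFP C).map (c ◁ f).op :=
  yoneda_tensor_ext (by
    simp only [comp_app, whiskerLeft_pure, yonedaTensorIso_pure, map_app_univ, pure_map_right,
      map_app])

lemma yonedaTensorIso_associativity (a b c : C) :
    (yonedaTensorIso a b).hom ▷ _ ≫ (yonedaTensorIso (a ⊗ b) c).hom ≫
        (yonedaFP C).map (α_ a b c).inv.op =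
      (α_ _ _ _).hom ≫ _ ◁ (yonedaTensorIso b c).hom ≫ (yonedaTensorIso a (b ⊗ c)).hom :=
  yoneda_tensor_ext₃ (by
    simp only [comp_app, whiskerLeft_pure, whiskerRight_pure, yonedaTensorIso_pure, map_app_univ,
      associator_pure, map_app])

lemma yonedaTensorIso_left_unitality (c : C) :
    (λ_ ((yonedaFP C).obj (op c))).hom =
      (𝟙 ((yonedaFP C).obj (op (𝟙_ C)))) ▷ (yonedaFP C).obj (op c) ≫
        (yonedaTensorIso (𝟙_ C) c).hom ≫ (yonedaFP C).map (λ_ c).inv.op :=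
  (yoneda_tensor_ext (c := 𝟙_ C) (by
    simp only [comp_app, whiskerRight_pure, yonedaTensorIso_pure, map_app_univ, id_app]
    exact (leftUnitor_pure (univ c)).symm)).symm

lemma yonedaTensorIso_right_unitality (c : C) :
    (ρ_ ((yonedaFP C).obj (op c))).hom =
      (yonedaFP C).obj (op c) ◁ (𝟙 ((yonedaFP C).obj (op (𝟙_ C)))) ≫
        (yonedaTensorIso c (𝟙_ C)).hom ≫ (yonedaFP C).map (ρ_ c).inv.op :=
  (yoneda_tensor_ext (d := 𝟙_ C) (by
    simp only [comp_app, whiskerLeft_pure, yonedaTensorIso_pure, map_app_univ, id_app]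
    exact (rightUnitor_pure (univ c)).symm)).symm

@[reducible]
noncomputable def yonedaMonoidal : (yonedaFP C).Monoidal :=
  Functor.CoreMonoidal.toMonoidal
  { εIso := Iso.refl _
    μIso c d := yonedaTensorIso c.unop d.unop
    μIso_hom_natural_left f X := yonedaTensorIso_naturality_left f.unop X.unop
    μIso_hom_natural_right X f := yonedaTensorIso_naturality_right X.unop f.unop
    associativity X Y Z := yonedaTensorIso_associativity X.unop Y.unop Z.unop
    left_unitality X := yonedaTensorIso_left_unitality X.unop
    right_unitality X := yonedaTensorIso_right_unitality X.unop }

lemma braiding_pure [SymmetricCategory C] {F G : FP C} {c d : C} (x : F.obj.obj c)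
    (y : G.obj.obj d) : (β_ F G).hom.hom.app _ (pure x y) =
      (G ⊗ F : FP C).obj.map (β_ d c).hom (pure y x) :=
  (exists_braiding F G).choose_spec c d x y

lemma yonedaTensorIso_braided [SymmetricCategory C] (c d : C) :
    (yonedaTensorIso c d).hom ≫ (yonedaFP C).map (β_ d c).hom.op =
      (β_ _ _).hom ≫ (yonedaTensorIso d c).hom :=
  yoneda_tensor_ext (by
    simp only [comp_app, braiding_pure, yonedaTensorIso_pure, map_app_univ, map_app])

@[reducible]
noncomputable def yonedaBraided [SymmetricCategory C] : (yonedaFP C).Braided where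
  toMonoidal := yonedaMonoidal
  braided c d := yonedaTensorIso_braided c.unop d.unop

theorem isSymmetricMonoidalFinitaryVariety [SymmetricCategory C] :
    IsSymmetricMonoidalFinitaryVariety (FP C) where
  closed := nonempty_monoidalClosed
  finitaryVariety := isFinitaryVariety
  unit_isFinitelyPresentable := isFinitelyPresentable_yoneda _
  exists_generator := ⟨representables C, isFinitaryQuasivarietyWith_representables, by
    rintro _ _ ⟨c⟩ ⟨d⟩
    exact FiniteProjective.isFiniteProjective_of_iso (yonedaTensorIso c.unop d.unop).symm
      (isFinitaryQuasivarietyWith_representables.le_isFiniteProjective _ ⟨_⟩)⟩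

end DayConvolution

/-- A symmetric monoidal structure on `C` whose tensor product preserves finite products in each
variable extends to the finite product preserving functors by Day convolution. -/
theorem exists_structure_FP {C : Type u} [SmallCategory C] [HasFiniteProducts C] (S : SymMonStr C)
    (hS : tensorPreservesFiniteProducts C S) :
    ∃ T : SymMonStr (FP C), isSMFVWithProjectiveUnit (FP C) T ∧
      Nonempty (yonedaStr S T).Braided := by
  let := S.monoidal
  let := S.symmetric
  have (c : C) : PreservesFiniteProducts (tensorLeft c) := (hS c).1
  have (c : C) : PreservesFiniteProducts (tensorRight c) := (hS c).2
  exact ⟨⟨inferInstance, inferInstance⟩, ⟨isSymmetricMonoidalFinitaryVariety,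
    isRegularProjective_yoneda _⟩, ⟨yonedaBraided⟩⟩

end FPFunctor

/-! ### Assembling the equivalence -/

namespace FPFunctor

open SymMonStr

variable {C : Type u} [SmallCategory C]

lemma yonedaCompatible_id {S : SymMonStr C} {T : SymMonStr (FP C)} (y : (yonedaStr S T).Braided) :
    YonedaCompatible (𝟙 S) (𝟙 T) y y := by
  have e {c : S.Carrierᵒᵖ} {X : T.Carrier} (m : X ⟶ (yonedaStr S T).obj c) :
      m ≫ (yonedaStr S T).map (𝟙 c) = m := by
    rw [CategoryTheory.Functor.map_id, Category.comp_id]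
  exact (yonedaCompatible_iff _ _ _ _).2 ⟨(e _).trans (Category.id_comp y.ε).symm,
    fun X Y ↦ (e _).trans (Category.id_comp (y.μ _ _)).symm⟩

lemma yonedaCompatible_comp {S S' S'' : SymMonStr C} {T T' T'' : SymMonStr (FP C)}
    {f : S ⟶ S'} {f' : S' ⟶ S''} {g : T ⟶ T'} {g' : T' ⟶ T''} {y : (yonedaStr S T).Braided}
    {y' : (yonedaStr S' T').Braided} {y'' : (yonedaStr S'' T'').Braided}
    (h : YonedaCompatible f g y y') (h' : YonedaCompatible f' g' y' y'') :
    YonedaCompatible (f ≫ f') (g ≫ g') y y'' := by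
  rw [yonedaCompatible_iff] at h h' ⊢
  have e {X Y Z W Z' Y' : FP C} {p : X ⟶ Y} {q : Y ⟶ Z} {r : Z ⟶ W} {p' : X ⟶ Y'} {q' : Y' ⟶ Z}
      {s : Y' ⟶ Z'} {t : Z' ⟶ W} {k : Y ⟶ W} (hk : k = q ≫ r) (h₁ : p ≫ q = p' ≫ q')
      (h₂ : q' ≫ r = s ≫ t) : p ≫ k = (p' ≫ s) ≫ t := by
    rw [hk, reassoc_of% h₁, h₂, Category.assoc]
  exact ⟨e ((yonedaFP C).map_comp _ _) h'.1 h.1,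
    fun X Y ↦ e ((yonedaFP C).map_comp _ _) (h'.2 X Y) (h.2 X Y)⟩

lemma nonempty_braided_yonedaStr {S : SymMonStr C} {T T' : SymMonStr (FP C)}
    (y : (yonedaStr S T).Braided) (k : T ⟶ T') : Nonempty (yonedaStr S T').Braided :=
  let _ := k.braided
  ⟨inferInstanceAs (yonedaStr S T ⋙ change T T').Braided⟩

end FPFunctor

open FPFunctor in
theorem mainTheorem12 (C : Type u) [SmallCategory C] [HasFiniteProducts C]
    [IsIdempotentComplete C] :
    ∃ (E : (tensorPreservesFiniteProducts C).FullSubcategory ≌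
        (isSMFVWithProjectiveUnit (FP C)).FullSubcategory)
      (y : ∀ S : (tensorPreservesFiniteProducts C).FullSubcategory,
        (yonedaStr S.obj (E.functor.obj S).obj).Braided),
      (∀ (S S' : (tensorPreservesFiniteProducts C).FullSubcategory) (f : S ⟶ S'),
        YonedaCompatible f.hom (E.functor.map f).hom (y S) (y S')) ∧
      ∀ T : (isSMFVWithProjectiveUnit (FP C)).FullSubcategory,
        Nonempty (yonedaStr (E.inverse.obj T).obj T.obj).Braided := by
  choose T hT y using fun S : (tensorPreservesFiniteProducts C).FullSubcategory ↦
    exists_structure_FP S.obj S.property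
  replace y S := (y S).some
  -- Stated for arbitrary structures linked by Yoneda, not only for the chosen `T S`: essential
  -- surjectivity compares a chosen extension with a given structure.
  have right {S S' : SymMonStr C} {T T' : SymMonStr (FP C)} (hT : isSMFVWithProjectiveUnit _ T)
      (hT' : isSMFVWithProjectiveUnit _ T') (y : (yonedaStr S T).Braided)
      (y' : (yonedaStr S' T').Braided) (f : S ⟶ S') : ∃! g : T ⟶ T', YonedaCompatible f g y y' := by
    obtain ⟨_⟩ := hT.1.closed
    obtain ⟨_⟩ := hT'.1.closed
    obtain ⟨g, hg⟩ := exists_yonedaCompatible_right f y y'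
    exact ⟨g, hg, fun g' hg' ↦ yonedaCompatible_right_unique f g' g y y' hg' hg⟩
  choose g hg hg' using fun (S S' : (tensorPreservesFiniteProducts C).FullSubcategory)
    (f : S.obj ⟶ S'.obj) ↦ right (hT S) (hT S') (y S) (y S') f
  let F : (tensorPreservesFiniteProducts C).FullSubcategory ⥤
      (isSMFVWithProjectiveUnit (FP C)).FullSubcategory :=
    { obj S := ⟨T S, hT S⟩
      map f := ⟨g _ _ f.hom⟩
      map_id S := by
        ext1
        exact (hg' S S _ _ (yonedaCompatible_id (y S))).symm
      map_comp {S S' S''} f f' := by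
        ext1
        exact (hg' S S'' _ _ (yonedaCompatible_comp (hg S S' f.hom) (hg S' S'' f'.hom))).symm }
  have : F.Faithful := ⟨fun {S S' f f'} h ↦ by
    ext1
    have h : g S S' f.hom = g S S' f'.hom := congrArg (·.hom) h
    exact yonedaCompatible_left_unique _ _ _ _ _ (hg _ _ f.hom) (h ▸ hg _ _ f'.hom)⟩
  have : F.Full := ⟨fun {S S'} k ↦ by
    obtain ⟨f, hf⟩ := exists_yonedaCompatible_left k.hom (y S) (y S')
    refine ⟨⟨f⟩, ?_⟩
    ext1
    exact (hg' S S' f _ hf).symm⟩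
  -- The given `T'` restricts to some `S`, whose chosen extension must be shown isomorphic to `T'`.
  -- Both lie over `S`, so `𝟙 S` lifts to morphisms `a` and `b` in both directions, and uniqueness
  -- of lifts of `𝟙 S` makes them mutually inverse.
  have : F.EssSurj := ⟨fun T' ↦ by
    obtain ⟨S, ⟨y'⟩⟩ := exists_braided_yonedaStr T'.obj T'.property
    obtain ⟨_⟩ := T'.property.1.closed
    let S' : (tensorPreservesFiniteProducts C).FullSubcategory :=
      ⟨S, tensorPreservesFiniteProducts_of_braided S T'.obj y'⟩
    obtain ⟨a, ha, -⟩ := right (hT S') T'.property (y S') y' (𝟙 S)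
    obtain ⟨b, hb, -⟩ := right T'.property (hT S') y' (y S') (𝟙 S)
    have hab := yonedaCompatible_comp ha hb
    have hba := yonedaCompatible_comp hb ha
    rw [Category.id_comp] at hab hba
    refine ⟨S', ⟨(ObjectProperty.fullyFaithfulι _).preimageIso ⟨a, b, ?_, ?_⟩⟩⟩
    · exact (right (hT S') (hT S') (y S') (y S') (𝟙 S)).unique hab (yonedaCompatible_id _)
    · exact (right T'.property T'.property y' y' (𝟙 S)).unique hba (yonedaCompatible_id _)⟩
  have : F.IsEquivalence := { }
  refine ⟨F.asEquivalence, y, fun S S' f ↦ hg S S' f.hom, fun T' ↦ ?_⟩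
  -- Yoneda is strong monoidal into the extension of the restricted structure, and the counit
  -- carries this to `T'`.
  exact nonempty_braided_yonedaStr (y _) (F.asEquivalence.counitIso.hom.app T').hom
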